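/- Let $n\ge 1$, let $V=\mathbb{C}^{n+1}$ with basis $v_1,\dots,v_{n+1}$, and let $\pi:Y\to R=\mathrm{Hom}(V,V)^{n-1}$ be the universal linear degeneration of the flag variety, i.e. $Y$ consists of the pairs $((f_1,\dots,f_{n-1}),(U_1,\dots,U_n))$ with $f_i\in\mathrm{End}(V)$, $U_i\subseteq V$ a subspace of dimension $i$, and $f_i(U_i)\subseteq U_{i+1}$ for $1\le i\le n-1$. Let $T_{\rm PBW}\subset R$ be the affine space of all tuples of the form $f_i(v_{i+1})=\lambda_{i}v_{i+1}$, $f_i(v_q)=v_q$ for $q\neq i+1$; the parameters $\lambda=(\lambda_1,\dots,\lambda_{n-1})$ identify $T_{\rm PBW}$ with $\mathbb{C}^{n-1}$. Then there exists a flat unipotent group scheme $\Gamma_{\rm PBW}\to T_{\rm PBW}$, affine and of finite type, which acts over $T_{\rm PBW}$ on $\pi^{-1}(T_{\rm PBW})\to T_{\rm PBW}$ with a dense orbit in each fibre: there is a section of $\pi^{-1}(T_{\rm PBW})\to T_{\rm PBW}$ such that, in every geometric fibre, the orbit of its value is Zariski dense. (Unipotent means that every nonzero finite-dimensional representation of every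 fibre of $\Gamma_{\rm PBW}$ has a nonzero fixed vector.) Explicitly, $\Gamma_{\rm PBW}$ can be taken to be the subgroup scheme of $\mathrm{GL}(V)^n\times T_{\rm PBW}\to T_{\rm PBW}$ of all $(g_1,\dots,g_n,\lambda)$ such that, for some $(x_{p,q})_{1\le q<p\le n+1}$ not depending on $i$, $$(g_i)_{p,q}=\begin{cases}0,&p<q,\\ 1,&p=q,\\ \lambda_{q-1}x_{p,q},&i<q<p,\\ x_{p,q},&q\le i<p,\\ \lambda_{p-1}x_{p,q},&q<p\le i,\end{cases}$$ acting by $(U_i)_i\mapsto(g_iU_i)_i$. -/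

import Mathlib

open CategoryTheory AlgebraicGeometry TensorProduct
open scoped MonObj

/-! Throughout `n = m + 1 ≥ 1`, and indices are shifted to start at `0`: vertices (the groups and
subspaces with index `1, …, n`) are indexed by `Fin (m + 1)`, the maps `f_1, …, f_{n-1}` by `Fin m`,
and the basis `v_1, …, v_{n+1}` of the ambient space `V` by `Fin (m + 2)`. -/

noncomputable section

namespace LinDeg

/-! ### Points of schemes over an affine base -/

section Points

variable {R : Type} [CommRing R]

/-- The `A`-valued points of a scheme `X` over `Spec R`, for an `R`-algebra `A`. If `X` is a group
scheme over `Spec R`, this is a group (Mathlib's `CategoryTheory.Hom.group`). -/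
abbrev Points (X : Over (Spec (.of R))) (A : Type) [CommRing A] [Algebra R A] : Type :=
  (Spec (.of A)).asOver (Spec (.of R)) ⟶ X

/-- Functoriality of `Points X A` in the `R`-algebra `A`. -/
def Points.map (X : Over (Spec (.of R))) {A B : Type} [CommRing A] [Algebra R A] [CommRing B]
    [Algebra R B] (φ : A →ₐ[R] B) (g : Points X A) : Points X B :=
  (Spec.map (CommRingCat.ofHom φ.toRingHom)).asOver (Spec (.of R)) ≫ g

/-- A group scheme `Γ` over `Spec R` is unipotent if it is affine over `Spec R` and each of its
fibres is unipotent: for every field `K` over `R`, every nonzero finite-dimensional linear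
representation of the `K`-group scheme `Γ_K` (a homomorphism `Γ(B) → GL_N(B)`, natural in the
`K`-algebra `B`) has a nonzero fixed vector. -/
structure IsUnipotent (Γ : Over (Spec (.of R))) [GrpObj Γ] : Prop where
  isAffineHom : IsAffineHom Γ.hom
  exists_fixed : ∀ (K : Type) [Field K] [Algebra R K] (N : ℕ)
    (r : ∀ (B : Type) [CommRing B] [Algebra R B] [Algebra K B] [IsScalarTower R K B],
      Points Γ B →* GL (Fin N) B),
    (∀ (B B' : Type) [CommRing B] [Algebra R B] [Algebra K B] [IsScalarTower R K B]
      [CommRing B'] [Algebra R B'] [Algebra K B'] [IsScalarTower R K B']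
      (φ : B →ₐ[K] B') (g : Points Γ B),
      r B' (Points.map Γ (φ.restrictScalars R) g) =
        Matrix.GeneralLinearGroup.map φ.toRingHom (r B g)) →
    0 < N →
    ∃ v : Fin N → K, v ≠ 0 ∧
      ∀ (B : Type) [CommRing B] [Algebra R B] [Algebra K B] [IsScalarTower R K B]
        (g : Points Γ B),
        (r B g : Matrix (Fin N) (Fin N) B).mulVec (fun j => algebraMap K B (v j)) =
          fun j => algebraMap K B (v j)

end Points

/-! ### Linear degenerate flag varieties -/

section Flags

variable {R : Type} [CommRing R] {m : ℕ}

/-- The family of linear degenerate flag varieties over `Spec R` defined by a tuple `f` of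
`m = n - 1` endomorphisms of `R^{n+1}`, as a functor on `R`-algebras: this is the base change of the
universal family `π : Y → Hom(V,V)^{n-1}` along the morphism `Spec R → Hom(V,V)^{n-1}` given by `f`.
Its `A`-points are the tuples of subbundles `U_i` of `A^{n+1} = A ⊗ R^{n+1}`, with `U_i` of rank
`i + 1` (i.e. with locally free quotient of rank `n - i`), such that `f_i (U_i) ⊆ U_{i+1}`. -/
def DegFlag (f : Fin m → Matrix (Fin (m + 2)) (Fin (m + 2)) R)
    (A : Type) [CommRing A] [Algebra R A] : Type :=
  {U : ∀ i : Fin (m + 1), Module.Grassmannian A (A ⊗[R] (Fin (m + 2) → R)) (m + 1 - (i : ℕ)) //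
    ∀ i : Fin m, (U i.castSucc).toSubmodule ≤
      (U i.succ).toSubmodule.comap ((Matrix.toLin' (f i)).baseChange A)}

/-- Functoriality of `DegFlag f A` in the `R`-algebra `A`. -/
def DegFlag.map (f : Fin m → Matrix (Fin (m + 2)) (Fin (m + 2)) R)
    {A B : Type} [CommRing A] [Algebra R A] [CommRing B] [Algebra R B] (φ : A →ₐ[R] B)
    (U : DegFlag f A) : DegFlag f B :=
  ⟨fun i => Module.Grassmannian.map φ (U.1 i), fun i => by
    algebraize [φ.toRingHom]
    have : IsScalarTower R A B := IsScalarTower.of_algebraMap_eq' φ.comp_algebraMap.symm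
    rw [Module.Grassmannian.map_toSubmodule, Module.Grassmannian.map_toSubmodule]
    have key : (Module.Grassmannian.baseChangeMkQ B (U.1 i.succ).toSubmodule) ∘ₗ
        (Matrix.toLin' (f i)).baseChange B =
        (((U.1 i.castSucc).toSubmodule.mapQ _ _ (U.2 i)).baseChange B) ∘ₗ
          Module.Grassmannian.baseChangeMkQ B (U.1 i.castSucc).toSubmodule := by
      refine TensorProduct.AlgebraTensorModule.ext fun b v => ?_
      simp [Module.Grassmannian.baseChangeMkQ]
    intro x hx
    have h := LinearMap.congr_fun key x
    simp only [LinearMap.comp_apply] at h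
    rw [LinearMap.mem_ker] at hx
    rw [Submodule.mem_comap, LinearMap.mem_ker]
    exact h.trans ((congrArg _ hx).trans (map_zero _))⟩

/-- The standard basis of `A ⊗ R^{n+1}`. -/
abbrev stdBasis (R : Type) [CommRing R] (m : ℕ) (A : Type) [CommRing A] [Algebra R A] :
    Module.Basis (Fin (m + 2)) A (A ⊗[R] (Fin (m + 2) → R)) :=
  (Pi.basisFun R (Fin (m + 2))).baseChange A

/-- The endomorphism of `A ⊗ R^{n+1}` with a given matrix in the standard basis. -/
abbrev matAct (R : Type) [CommRing R] {m : ℕ} {A : Type} [CommRing A] [Algebra R A]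
    (M : Matrix (Fin (m + 2)) (Fin (m + 2)) A) :
    A ⊗[R] (Fin (m + 2) → R) →ₗ[A] A ⊗[R] (Fin (m + 2) → R) :=
  Matrix.toLin (stdBasis R m A) (stdBasis R m A) M

end Flags

/-! ### The Zariski topology on the points of a linear degenerate flag variety -/

section Zariski

variable {R : Type} [CommRing R] {m : ℕ}

/-- `K`-points of the product `Gr_1(V) × ⋯ × Gr_n(V)`, for a field `K` over `R`. -/
abbrev GrProd (R : Type) [CommRing R] (m : ℕ) (K : Type) [Field K] [Algebra R K] : Type :=
  ∀ i : Fin (m + 1), Module.Grassmannian K (K ⊗[R] (Fin (m + 2) → R)) (m + 1 - (i : ℕ))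

/-- A frame of a tuple of subspaces: matrices `M_i` of size `(n+1) × (i+1)` whose columns span `U_i`
(and hence form a basis of `U_i`, since `dim U_i = i + 1`). -/
def IsFrame {K : Type} [Field K] [Algebra R K]
    (M : ∀ i : Fin (m + 1), Matrix (Fin (m + 2)) (Fin ((i : ℕ) + 1)) K) (U : GrProd R m K) : Prop :=
  ∀ i, (U i).toSubmodule =
    Submodule.span K (Set.range fun j => ∑ p, M i p j • stdBasis R m K p)

/-- Zariski closed subsets of `Gr_1(V) × ⋯ × Gr_n(V)`. This variety is the quotient of the variety
of frames, an open subvariety of an affine space, by the group `∏ GL_i` acting by change of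
frames, and carries the quotient topology: a subset is closed if and only if the set of its
frames is cut out by polynomials in the matrix entries. -/
def IsZariskiClosed {K : Type} [Field K] [Algebra R K] (C : Set (GrProd R m K)) : Prop :=
  ∃ S : Set (MvPolynomial (Σ i : Fin (m + 1), Fin (m + 2) × Fin ((i : ℕ) + 1)) K),
    ∀ (U : GrProd R m K) (M : ∀ i : Fin (m + 1), Matrix (Fin (m + 2)) (Fin ((i : ℕ) + 1)) K),
      IsFrame M U →
        (U ∈ C ↔ ∀ P ∈ S, MvPolynomial.eval (fun t => M t.1 t.2.1 t.2.2) P = 0)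

/-- A set of `K`-points of the linear degenerate flag variety is dense in the Zariski topology
(the subspace topology from `Gr_1(V) × ⋯ × Gr_n(V)`). -/
def IsZariskiDense {f : Fin m → Matrix (Fin (m + 2)) (Fin (m + 2)) R} {K : Type} [Field K]
    [Algebra R K] (O : Set (DegFlag f K)) : Prop :=
  ∀ C : Set (GrProd R m K), IsZariskiClosed C → (∀ U ∈ O, U.1 ∈ C) → ∀ U : DegFlag f K, U.1 ∈ C

end Zariski

/-! ### The slice and the matrices of the group scheme -/

/-- The coordinate ring `ℂ[λ_{11}, …, λ_{n-1,n-1}]` of the slice `T_PBW ≅ ℂ^{n-1}`. -/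
abbrev SliceRing (m : ℕ) : Type := MvPolynomial (Fin m) ℂ

/-- The point of the slice with parameters `l`: the map `f_i` is diagonal in the basis `v_1, …,
v_{n+1}`, with `f_i (v_{i+1}) = λ_{ii} v_{i+1}` and `f_i (v_q) = v_q` for `q ≠ i + 1`
(in indices starting at `1`). -/
def slice {m : ℕ} {A : Type} [CommRing A] (l : Fin m → A) (i : Fin m) :
    Matrix (Fin (m + 2)) (Fin (m + 2)) A :=
  Matrix.diagonal fun q => if q = i.succ.castSucc then l i else 1

/-- The tautological point of the slice, with values in its coordinate ring; the family `DegFlag` of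
this tuple is `π⁻¹(T_PBW) → T_PBW`. -/
abbrev univSlice (m : ℕ) : Fin m → Matrix (Fin (m + 2)) (Fin (m + 2)) (SliceRing m) :=
  slice MvPolynomial.X

/-- `λ_{k-1,k-1}` (for `2 ≤ k ≤ n`) in indices starting at `1`, that is, the parameter with index
`k - 1` (for `1 ≤ k ≤ m`) in indices starting at `0`. The value at other `k` is irrelevant. -/
def param {m : ℕ} {A : Type} [CommRing A] (l : Fin m → A) (k : Fin (m + 2)) : A :=
  if h : (k : ℕ) - 1 < m then l ⟨(k : ℕ) - 1, h⟩ else 0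

/-- The lower unitriangular matrix `g_i(λ)` with parameters `x_{p,q}`, `p > q`. -/
def pbwMatrix {m : ℕ} {A : Type} [CommRing A] (l : Fin m → A)
    (x : Fin (m + 2) → Fin (m + 2) → A) (i : Fin (m + 1)) :
    Matrix (Fin (m + 2)) (Fin (m + 2)) A :=
  Matrix.of fun p q =>
    if p < q then 0
    else if p = q then 1
    else if (i : ℕ) < q then param l q * x p q
    else if (p : ℕ) ≤ i then param l p * x p q
    else x p q

end LinDeg

end

/-! The explicit matrices are exactly the tuples of lower unitriangular `g_i` with `f_i g_i =
g_{i+1} f_i`. In the shifted indices, this relation says that the entry at `(p, q)` does not change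
with `i`, except for a factor `λ` picked up when moving from vertex `q` down to `q - 1` or up into
vertex `p`. So the tuple is freely determined by the entries of `g_q` in column `q`
(`eq_pbwMatrix_of_compat`, `slice_mul_pbwMatrix`). The commutation relation gives a group acting on
the family; the free coordinates make it an affine space over the slice, hence flat, affine and of
finite type.

Unipotence comes from the endomorphisms `x_{p,q} ↦ t^{p-q} x_{p,q}`, which contract the group to `1`
at `t = 0`. For a representation `r`, the matrix `r(t·h)` is a polynomial in `t` with constant term
`1`; let `r_d` be its highest coefficient that is not identically zero. Comparing degrees in `r(t·(g
(s·h))) = r(t·g) r(ts·h)` gives `r_a(g) r_d(h) = 0` for `a > 0`. Hence `r(g) r_d(h) = r_d(h)`, and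
the columns of `r_d` supply fixed vectors (`exists_fixed_vector`).

For density, the orbit of the standard flag contains every flag transversal to the complementary
coordinate subspaces (`exists_smul_stdFlag_eq`). Every other flag is a limit of these
(`IsChainFlag.mem_closure_bigCell`), because each `f_i` has kernel of dimension at most one. If
every `f_i` is injective on `U_i`, the flag is generated by one new vector per step, and these
vectors can be moved linearly to basis vectors. Otherwise a kernel vector gives a deformation along
a line that increases the bounded sum of ranks of the composite maps
(`IsChainFlag.exists_deformation`), and induction applies. Over an infinite field a polynomial
vanishing at almost all points of a line vanishes on the line, so closed sets contain these limits.
-/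

noncomputable section

namespace LinDeg

/-! ### The group of compatible unitriangular tuples and its free coordinates -/

section Matrices

variable {m : ℕ} {A B : Type} [CommRing A] [CommRing B]

theorem mul_diag_of_lowerTriangular {n : Type} [Fintype n] [LinearOrder n] {M N : Matrix n n A}
    (hM : M.BlockTriangular OrderDual.toDual) (hN : N.BlockTriangular OrderDual.toDual) (p : n) :
    (M * N) p p = M p p * N p p := by
  rw [Matrix.mul_apply]
  refine Finset.sum_eq_single p (fun r _ hr => ?_) (by simp)
  rcases lt_or_gt_of_ne hr with h | h
  · rw [hN (show OrderDual.toDual p < OrderDual.toDual r from h), mul_zero]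
  · rw [hM (show OrderDual.toDual r < OrderDual.toDual p from h), zero_mul]

/-- The tuples of lower unitriangular matrices which are compatible with the tuple of
endomorphisms `slice l`. -/
def pbwGroup (l : Fin m → A) : Subgroup (Fin (m + 1) → GL (Fin (m + 2)) A) where
  carrier := {g | (∀ i, (g i).1.BlockTriangular OrderDual.toDual) ∧ (∀ i p, (g i).1 p p = 1) ∧
    ∀ i : Fin m, slice l i * (g i.castSucc).1 = (g i.succ).1 * slice l i}
  mul_mem' := by
    rintro g h ⟨g1, g2, g3⟩ ⟨h1, h2, h3⟩
    refine ⟨fun i => (g1 i).mul (h1 i), fun i p => ?_, fun i => ?_⟩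
    · exact (mul_diag_of_lowerTriangular (g1 i) (h1 i) p).trans (by rw [g2, h2, one_mul])
    · change slice l i * ((g i.castSucc).1 * (h i.castSucc).1) =
        ((g i.succ).1 * (h i.succ).1) * slice l i
      rw [← mul_assoc, g3, mul_assoc, h3, mul_assoc]
  one_mem' := by
    refine ⟨fun i => Matrix.blockTriangular_one, fun i p => Matrix.one_apply_eq p, fun i => ?_⟩
    change slice l i * 1 = 1 * slice l i
    simp
  inv_mem' := by
    rintro g ⟨g1, g2, g3⟩
    have key : ∀ i, ((g⁻¹) i).1.BlockTriangular OrderDual.toDual := fun i => by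
      have : Invertible (g i).1 := (g i).invertible
      have := Matrix.blockTriangular_inv_of_blockTriangular (g1 i)
      rwa [← Matrix.coe_units_inv] at this
    have hm : ∀ i, (g i).1 * ((g⁻¹) i).1 = 1 := fun i => (g i).mul_inv
    have hm' : ∀ i, ((g⁻¹) i).1 * (g i).1 = 1 := fun i => (g i).inv_mul
    refine ⟨key, fun i p => ?_, fun i => ?_⟩
    · have := mul_diag_of_lowerTriangular (g1 i) (key i) p
      rw [hm, g2, one_mul, Matrix.one_apply_eq] at this
      exact this.symm
    · calc slice l i * ((g⁻¹) i.castSucc).1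
          = ((g⁻¹) i.succ).1 * ((g i.succ).1 * slice l i) * ((g⁻¹) i.castSucc).1 := by
            rw [← mul_assoc _ (g i.succ).1, hm', one_mul]
        _ = ((g⁻¹) i.succ).1 * slice l i := by
            rw [← g3, mul_assoc, mul_assoc, hm, mul_one]

theorem slice_mul_apply (l : Fin m → A) (i : Fin m) (M : Matrix (Fin (m + 2)) (Fin (m + 2)) A)
    (p q : Fin (m + 2)) :
    (slice l i * M) p q = (if p = i.succ.castSucc then l i else 1) * M p q := by
  rw [slice, Matrix.diagonal_mul]

theorem mul_slice_apply (l : Fin m → A) (i : Fin m) (M : Matrix (Fin (m + 2)) (Fin (m + 2)) A)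
    (p q : Fin (m + 2)) :
    (M * slice l i) p q = M p q * (if q = i.succ.castSucc then l i else 1) := by
  rw [slice, Matrix.mul_diagonal]

theorem param_succ_castSucc (l : Fin m → A) (i : Fin m) : param l i.succ.castSucc = l i := by
  simp [param]

/-- The relation between vertices `i` and `i + 1` can be read off entrywise because the slice is
diagonal. Started at vertex `q`, it expresses the entry at `(p, q)` at every other vertex without
any division by `λ`, so the argument is valid where parameters vanish. -/
theorem eq_pbwMatrix_of_compat (l : Fin m → A)
    (g : Fin (m + 1) → Matrix (Fin (m + 2)) (Fin (m + 2)) A)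
    (g1 : ∀ i, (g i).BlockTriangular OrderDual.toDual) (g2 : ∀ i p, g i p p = 1)
    (g3 : ∀ i : Fin m, slice l i * g i.castSucc = g i.succ * slice l i)
    (x : Fin (m + 2) → Fin (m + 2) → A)
    (hx : ∀ (p q : Fin (m + 2)) (h : q < p),
      x p q = g ⟨q, by have := p.2; have : (q : ℕ) < p := h; omega⟩ p q) (i : Fin (m + 1)) :
    g i = pbwMatrix l x i := by
  have step : ∀ (p q : Fin (m + 2)) (i : Fin m),
      (if p = i.succ.castSucc then l i else 1) * g i.castSucc p q =
        g i.succ p q * (if q = i.succ.castSucc then l i else 1) := fun p q i => by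
    rw [← slice_mul_apply, ← mul_slice_apply, g3]
  ext p q
  simp only [pbwMatrix, Matrix.of_apply]
  split_ifs with h1 h2 h3 h4
  · exact g1 i (show OrderDual.toDual q < OrderDual.toDual p from h1)
  · rw [h2, g2]
  · have hqp : q < p := lt_of_le_of_ne (not_lt.mp h1) (Ne.symm h2)
    have hqp' : (q : ℕ) < p := hqp
    have hqm : (q : ℕ) ≤ m := by omega
    obtain ⟨k, hk⟩ : ∃ k : ℕ, (q : ℕ) = k + 1 := ⟨q - 1, by omega⟩
    have hkm : k < m := by omega
    have hq : q = (⟨k, hkm⟩ : Fin m).succ.castSucc := Fin.ext hk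
    have hpar : param l q = l ⟨k, hkm⟩ := by rw [hq, param_succ_castSucc]
    -- Descend from vertex `q = k + 1`: the passage to `k` gives the factor `λ`, and below that
    -- neither `p` nor `q` is the exceptional index.
    have key : ∀ j : ℕ, ∀ hj : j ≤ k, g ⟨j, by omega⟩ p q = param l q * x p q := by
      intro j hj
      induction hj using Nat.decreasingInduction with
      | self =>
        have := step p q ⟨k, hkm⟩
        rw [if_pos hq, if_neg (fun h => h2 (h.trans hq.symm)), one_mul] at this
        have e : (⟨q, by omega⟩ : Fin (m + 1)) = (⟨k, hkm⟩ : Fin m).succ := Fin.ext hk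
        rw [hx p q hqp, hpar, mul_comm, e]
        exact this
      | of_succ j hj ih =>
        have := step p q ⟨j, by omega⟩
        rw [if_neg (fun h => by have := congrArg Fin.val h; simp at this; omega),
          if_neg (fun h => by have := congrArg Fin.val h; simp at this; omega),
          one_mul, mul_one] at this
        rw [← ih]
        exact this
    exact key i (by omega)
  all_goals
    have hqp : q < p := lt_of_le_of_ne (not_lt.mp h1) (Ne.symm h2)
    have hqp' : (q : ℕ) < p := hqp
    -- Ascend from vertex `q`: the only factor appears on reaching vertex `p`.
    have key : ∀ j : ℕ, (hj : (q : ℕ) ≤ j) → (hjm : j < m + 1) → g ⟨j, hjm⟩ p q =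
        if (p : ℕ) ≤ j then param l p * x p q else x p q := by
      intro j hj
      induction j, hj using Nat.le_induction with
      | base =>
        intro _
        rw [if_neg (by omega), hx p q hqp]
      | succ j hj ih =>
        intro hjm
        have hs := step p q ⟨j, by omega⟩
        rw [if_neg (c := q = _) (fun h => by have := congrArg Fin.val h; simp at this; omega),
          mul_one] at hs
        refine (show _ = _ from hs.symm).trans ?_
        have ih' := ih (by omega)
        rw [show g (Fin.castSucc ⟨j, by omega⟩) p q = _ from ih']
        by_cases hp : (p : ℕ) = j + 1
        · have hp' : p = (⟨j, by omega⟩ : Fin m).succ.castSucc := Fin.ext hp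
          have hpar : param l p = l ⟨j, by omega⟩ :=
            (congrArg _ hp').trans (param_succ_castSucc _ _)
          rw [if_pos hp', if_neg (by omega), if_pos (by omega), hpar]
        · rw [if_neg (fun h => by have := congrArg Fin.val h; simp at this; omega), one_mul]
          simp only [show (p : ℕ) ≤ j + 1 ↔ (p : ℕ) ≤ j by omega]
    have := key i (by omega) i.2
    simpa [h4] using this

theorem pbwMatrix_lowerTriangular (l : Fin m → A) (x : Fin (m + 2) → Fin (m + 2) → A)
    (i : Fin (m + 1)) : (pbwMatrix l x i).BlockTriangular OrderDual.toDual := by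
  intro p q h
  exact if_pos (show p < q from h)

theorem pbwMatrix_apply_self (l : Fin m → A) (x : Fin (m + 2) → Fin (m + 2) → A)
    (i : Fin (m + 1)) (p : Fin (m + 2)) : pbwMatrix l x i p p = 1 := by
  simp [pbwMatrix]

theorem pbwMatrix_apply_of_lt (l : Fin m → A) (x : Fin (m + 2) → Fin (m + 2) → A)
    (i : Fin (m + 1)) {p q : Fin (m + 2)} (hq : (q : ℕ) ≤ i) (hp : (i : ℕ) < p) :
    pbwMatrix l x i p q = x p q := by
  have h : (q : ℕ) < p := by omega
  rw [pbwMatrix, Matrix.of_apply, if_neg (by omega), if_neg (by omega), if_neg (by omega),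
    if_neg (by omega)]

theorem det_pbwMatrix (l : Fin m → A) (x : Fin (m + 2) → Fin (m + 2) → A) (i : Fin (m + 1)) :
    (pbwMatrix l x i).det = 1 := by
  rw [Matrix.det_of_isLowerTriangular _ (pbwMatrix_lowerTriangular l x i)]
  simp [pbwMatrix_apply_self]

/-- Between vertices `i` and `i + 1` the case distinction in `pbwMatrix` changes only for `p = i +
1` or `q = i + 1`, exactly where the slice contributes a parameter on one side. -/
theorem slice_mul_pbwMatrix (l : Fin m → A) (x : Fin (m + 2) → Fin (m + 2) → A) (i : Fin m) :
    slice l i * pbwMatrix l x i.castSucc = pbwMatrix l x i.succ * slice l i := by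
  ext p q
  rw [slice_mul_apply, mul_slice_apply]
  simp only [pbwMatrix, Matrix.of_apply]
  by_cases h1 : p < q
  · simp [h1]
  by_cases h2 : p = q
  · simp [h2]
  have hqp : (q : ℕ) < p := lt_of_le_of_ne (not_lt.mp h1) (Fin.val_ne_of_ne (Ne.symm h2))
  simp only [h1, h2, if_false]
  by_cases hp : p = i.succ.castSucc
  · have hp' : (p : ℕ) = i + 1 := by simp [hp]
    have hpar : param l p = l i := by rw [hp, param_succ_castSucc]
    have hq : q ≠ i.succ.castSucc := fun h => h2 (hp.trans h.symm)
    simp only [Fin.val_castSucc, Fin.val_succ]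
    rw [if_pos hp, if_neg hq, if_neg (by omega), if_neg (by omega), if_neg (by omega),
      if_pos (by omega), hpar, mul_one]
  · have hp' : (p : ℕ) ≠ i + 1 := fun h => hp (Fin.ext (by simpa using h))
    rw [if_neg hp, one_mul]
    by_cases hq : q = i.succ.castSucc
    · have hq' : (q : ℕ) = i + 1 := by simp [hq]
      have hpar : param l q = l i := by rw [hq, param_succ_castSucc]
      simp only [Fin.val_castSucc, Fin.val_succ]
      rw [if_pos hq, if_pos (by omega), if_neg (by omega), if_neg (by omega), hpar, mul_comm]
    · have hq' : (q : ℕ) ≠ i + 1 := fun h => hq (Fin.ext (by simpa using h))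
      rw [if_neg hq, mul_one]
      simp only [Fin.val_castSucc, Fin.val_succ]
      simp only [show (i : ℕ) + 1 < q ↔ (i : ℕ) < q by omega,
        show (p : ℕ) ≤ i + 1 ↔ (p : ℕ) ≤ i by omega]

theorem mem_pbwGroup_of_eq {l : Fin m → A} {g : Fin (m + 1) → GL (Fin (m + 2)) A}
    {x : Fin (m + 2) → Fin (m + 2) → A} (h : ∀ i, (g i).1 = pbwMatrix l x i) :
    g ∈ pbwGroup l := by
  refine ⟨fun i => ?_, fun i p => ?_, fun i => ?_⟩
  · rw [h]; exact pbwMatrix_lowerTriangular l x i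
  · rw [h, pbwMatrix_apply_self]
  · rw [h, h, slice_mul_pbwMatrix]

/-- The positions below the diagonal. -/
abbrev Below (m : ℕ) : Type := {s : Fin (m + 2) × Fin (m + 2) // s.2 < s.1}

/-- The vertex with the index of the column of a position below the diagonal. -/
def Below.vertex (s : Below m) : Fin (m + 1) :=
  ⟨s.1.2, by have := s.1.1.2; have : (s.1.2 : ℕ) < s.1.1 := s.2; omega⟩

/-- Extension of a function on the positions below the diagonal by zero. -/
def extendBelow (x : Below m → A) (p q : Fin (m + 2)) : A :=
  if h : q < p then x ⟨(p, q), h⟩ else 0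

/-- The coordinates of the group `pbwGroup l`. -/
def pbwCoord (l : Fin m → A) : pbwGroup l ≃ (Below m → A) where
  toFun g s := (g.1 s.vertex).1 s.1.1 s.1.2
  invFun x := ⟨fun i => Matrix.GeneralLinearGroup.mk'' (pbwMatrix l (extendBelow x) i)
    (by rw [det_pbwMatrix]; exact isUnit_one), mem_pbwGroup_of_eq (fun _ => rfl)⟩
  left_inv g := by
    obtain ⟨g, g1, g2, g3⟩ := g
    refine Subtype.ext (funext fun i => Units.ext ?_)
    refine (eq_pbwMatrix_of_compat l (fun i => (g i).1) g1 g2 g3 _ (fun p q h => ?_) i).symm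
    exact dif_pos h
  right_inv x := by
    funext s
    refine (pbwMatrix_apply_of_lt l _ s.vertex le_rfl s.2).trans ?_
    exact dif_pos s.2

theorem mem_pbwGroup_iff {l : Fin m → A} {g : Fin (m + 1) → GL (Fin (m + 2)) A} :
    g ∈ pbwGroup l ↔ ∃ x, ∀ i, (g i).1 = pbwMatrix l x i := by
  refine ⟨fun h => ⟨extendBelow (pbwCoord l ⟨g, h⟩), fun i => ?_⟩, fun ⟨x, h⟩ =>
    mem_pbwGroup_of_eq h⟩
  have := (pbwCoord l).symm_apply_apply ⟨g, h⟩
  exact congrArg (fun y => (y.1 i).1) this.symm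

theorem exists_pbwGroup_eq (l : Fin m → A) (x : Fin (m + 2) → Fin (m + 2) → A) :
    ∃ g : pbwGroup l, ∀ i, (g.1 i).1 = pbwMatrix l x i :=
  ⟨⟨fun i => Matrix.GeneralLinearGroup.mk'' (pbwMatrix l x i)
    (by rw [det_pbwMatrix]; exact isUnit_one), mem_pbwGroup_of_eq (fun _ => rfl)⟩, fun _ => rfl⟩

theorem map_slice (φ : A →+* B) (l : Fin m → A) (i : Fin m) :
    (slice l i).map φ = slice (fun k => φ (l k)) i := by
  rw [slice, slice, Matrix.diagonal_map (map_zero φ)]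
  congr 1
  funext q
  simp [apply_ite φ]

/-- Functoriality of the group `pbwGroup l` in the ring. -/
def pbwGroup.map (φ : A →+* B) {l : Fin m → A} {l' : Fin m → B} (h : ∀ k, φ (l k) = l' k) :
    pbwGroup l →* pbwGroup l' where
  toFun g := ⟨fun i => Matrix.GeneralLinearGroup.map φ (g.1 i), by
    obtain ⟨g, g1, g2, g3⟩ := g
    obtain rfl : (fun k => φ (l k)) = l' := funext h
    refine ⟨fun i => (g1 i).map φ, fun i p => ?_, fun i => ?_⟩
    · exact (congrArg φ (g2 i p)).trans (map_one φ)
    · have := congrArg (fun M => M.map φ) (g3 i)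
      simp only [Matrix.map_mul, map_slice] at this
      exact this⟩
  map_one' := Subtype.ext (funext fun i => map_one _)
  map_mul' g h := Subtype.ext (funext fun i => map_mul _ _ _)

theorem pbwCoord_map (φ : A →+* B) {l : Fin m → A} {l' : Fin m → B} (h : ∀ k, φ (l k) = l' k)
    (g : pbwGroup l) (s : Below m) :
    pbwCoord l' (pbwGroup.map φ h g) s = φ (pbwCoord l g s) := rfl

/-- Needed because the global functions on `Spec A` are only isomorphic to `A`. -/
theorem pbwGroup.map_bijective {φ : A →+* B} (hφ : Function.Bijective φ) {l : Fin m → A}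
    {l' : Fin m → B} (h : ∀ k, φ (l k) = l' k) : Function.Bijective (pbwGroup.map φ h) := by
  constructor
  · intro g g' hg
    refine (pbwCoord _).injective (funext fun s => hφ.1 ?_)
    exact congrFun (congrArg (pbwCoord _) hg) s
  · intro g
    choose x hx using fun s => hφ.2 (pbwCoord _ g s)
    refine ⟨(pbwCoord _).symm x, (pbwCoord _).injective (funext fun s => ?_)⟩
    rw [pbwCoord_map, Equiv.apply_symm_apply, hx]

end Matrices

/-! ### Representability by an affine space over the slice -/

section GroupScheme

variable {m : ℕ}

/-- The structure morphism of the ring of global functions of a scheme over `Spec R`. -/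
def globalSectionsMap {R : Type} [CommRing R] (X : Over (Spec (.of R))) :
    R →+* Γ(X.left, ⊤) :=
  ((Scheme.ΓSpecIso (.of R)).inv ≫ X.hom.appTop).hom

theorem appTop_globalSectionsMap {R : Type} [CommRing R] {X Y : Over (Spec (.of R))} (f : X ⟶ Y)
    (a : R) : f.left.appTop.hom (globalSectionsMap Y a) = globalSectionsMap X a := by
  have h : globalSectionsMap X =
      ((Scheme.ΓSpecIso (.of R)).inv ≫ (f.left ≫ Y.hom).appTop).hom := by
    rw [Over.w]; rfl
  rw [h, Scheme.Hom.comp_appTop]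
  rfl

/-- The group functor `pbwGroup` on schemes over the slice. -/
def pbwFunctor (m : ℕ) : (Over (Spec (.of (SliceRing m))))ᵒᵖ ⥤ GrpCat where
  obj X := GrpCat.of (pbwGroup fun k => globalSectionsMap X.unop (MvPolynomial.X k))
  map f := GrpCat.ofHom
    (pbwGroup.map f.unop.left.appTop.hom fun _ => appTop_globalSectionsMap f.unop _)
  map_id X := GrpCat.hom_ext <| MonoidHom.ext fun g => (pbwCoord _).injective <| funext fun s => by
    refine (pbwCoord_map (𝟙 X : X ⟶ X).unop.left.appTop.hom
      (fun _ => appTop_globalSectionsMap (𝟙 X : X ⟶ X).unop _) g s).trans ?_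
    simp
  map_comp {X Y Z} f h :=
    GrpCat.hom_ext <| MonoidHom.ext fun g => (pbwCoord _).injective <| funext fun s => by
    refine (pbwCoord_map (f ≫ h).unop.left.appTop.hom
      (fun _ => appTop_globalSectionsMap (f ≫ h).unop _) g s).trans ?_
    simp
    rfl

/-- The group scheme over the slice with the coordinates `x_{p,q}` for `q < p`. -/
def pbwScheme (m : ℕ) : Over (Spec (.of (SliceRing m))) :=
  Over.mk (𝔸(Below m; Spec (.of (SliceRing m))) ↘ Spec (.of (SliceRing m)))

/-- Morphisms to the group scheme, as tuples of matrices over the ring of global functions. -/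
def homPbwSchemeEquiv (X : Over (Spec (.of (SliceRing m)))) : (X ⟶ pbwScheme m) ≃
    pbwGroup fun k => globalSectionsMap X (MvPolynomial.X (R := ℂ) k) where
  toFun f := (pbwCoord _).symm fun s => f.left.appTop (AffineSpace.coord _ s)
  invFun g := Over.homMk (AffineSpace.homOfVector X.hom (pbwCoord _ g))
    (AffineSpace.homOfVector_over _ _)
  left_inv f := by
    refine Over.OverMorphism.ext (AffineSpace.hom_ext ?_ fun s => ?_)
    · exact (AffineSpace.homOfVector_over _ _).trans (Over.w f).symm
    · simp only [Equiv.apply_symm_apply]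
      exact AffineSpace.homOfVector_appTop_coord _ _ _
  right_inv g := by
    refine (Equiv.symm_apply_eq _).mpr (funext fun s => ?_)
    exact AffineSpace.homOfVector_appTop_coord _ _ _

theorem pbwCoord_homPbwSchemeEquiv {X : Over (Spec (.of (SliceRing m)))} (f : X ⟶ pbwScheme m)
    (s : Below m) : pbwCoord _ (homPbwSchemeEquiv X f) s =
      f.left.appTop (AffineSpace.coord _ s) :=
  congrFun ((pbwCoord _).apply_symm_apply _) s

theorem homPbwSchemeEquiv_comp {X Y : Over (Spec (.of (SliceRing m)))} (f : X ⟶ Y)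
    (g : Y ⟶ pbwScheme m) : homPbwSchemeEquiv X (f ≫ g) =
      pbwGroup.map f.left.appTop.hom (fun _ => appTop_globalSectionsMap f _)
        (homPbwSchemeEquiv Y g) := by
  refine (pbwCoord _).injective (funext fun s => ?_)
  rw [pbwCoord_map, pbwCoord_homPbwSchemeEquiv, pbwCoord_homPbwSchemeEquiv,
    Over.comp_left, Scheme.Hom.comp_appTop]
  rfl

/-- The group scheme over the slice represents `pbwFunctor`. -/
def pbwRepresentableBy (m : ℕ) :
    (pbwFunctor m ⋙ forget _).RepresentableBy (pbwScheme m) where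
  homEquiv {X} := homPbwSchemeEquiv X
  homEquiv_comp f g := homPbwSchemeEquiv_comp f g

instance (m : ℕ) : GrpObj (pbwScheme m) :=
  GrpObj.ofRepresentableBy _ (pbwFunctor m) (pbwRepresentableBy m)

theorem homPbwSchemeEquiv_mul {X : Over (Spec (.of (SliceRing m)))} (f g : X ⟶ pbwScheme m) :
    homPbwSchemeEquiv X (f * g) = homPbwSchemeEquiv X f * homPbwSchemeEquiv X g :=
  ((yonedaGrpObjIsoOfRepresentableBy (pbwScheme m) (pbwFunctor m)
    (pbwRepresentableBy m)).hom.app (.op X)).hom.map_mul f g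

theorem ΓSpecIso_globalSectionsMap {R A : Type} [CommRing R] [CommRing A] [Algebra R A] (a : R) :
    (Scheme.ΓSpecIso (.of A)).hom.hom
      (globalSectionsMap ((Spec (.of A)).asOver (Spec (.of R))) a) = algebraMap R A a := by
  have := Scheme.ΓSpecIso_inv_naturality (CommRingCat.ofHom (algebraMap R A))
  have h2 : globalSectionsMap ((Spec (.of A)).asOver (Spec (.of R))) =
    (CommRingCat.ofHom (algebraMap R A) ≫ (Scheme.ΓSpecIso (.of A)).inv).hom := by
    rw [this]; rfl
  rw [h2]
  exact congr($((Scheme.ΓSpecIso (.of A)).inv_hom_id).hom (algebraMap R A a))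

/-- The parameters of the slice in an algebra over its coordinate ring. -/
abbrev sliceParam (m : ℕ) (A : Type) [CommRing A] [Algebra (SliceRing m) A] (k : Fin m) : A :=
  algebraMap (SliceRing m) A (MvPolynomial.X k)

section Points

variable {A B : Type} [CommRing A] [Algebra (SliceRing m) A] [CommRing B] [Algebra (SliceRing m) B]

/-- The points of the group scheme over the slice, as tuples of matrices. -/
def pointsHom (m : ℕ) (A : Type) [CommRing A] [Algebra (SliceRing m) A] :
    Points (pbwScheme m) A →* pbwGroup (sliceParam m A) :=
  (pbwGroup.map (Scheme.ΓSpecIso (.of A)).hom.hom fun _ => ΓSpecIso_globalSectionsMap _).comp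
    (MonoidHom.mk' (homPbwSchemeEquiv _) homPbwSchemeEquiv_mul)

theorem pbwCoord_pointsHom (g : Points (pbwScheme m) A) (s : Below m) :
    pbwCoord _ (pointsHom m A g) s =
      (Scheme.ΓSpecIso (.of A)).hom.hom (g.left.appTop.hom (AffineSpace.coord _ s)) :=
  (pbwCoord_map (Scheme.ΓSpecIso (.of A)).hom.hom (fun _ => ΓSpecIso_globalSectionsMap _)
    (homPbwSchemeEquiv _ g) s).trans (congrArg _ (pbwCoord_homPbwSchemeEquiv g s))

theorem pointsHom_bijective : Function.Bijective (pointsHom m A) :=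
  (pbwGroup.map_bijective (ConcreteCategory.bijective_of_isIso (Scheme.ΓSpecIso (.of A)).hom)
    fun _ => ΓSpecIso_globalSectionsMap _).comp (homPbwSchemeEquiv _).bijective

theorem pointsHom_map (φ : A →ₐ[SliceRing m] B) (g : Points (pbwScheme m) A) :
    pointsHom m B (Points.map (pbwScheme m) φ g) =
      pbwGroup.map φ.toRingHom (fun _ => φ.commutes _) (pointsHom m A g) := by
  refine (pbwCoord _).injective (funext fun s => ?_)
  rw [pbwCoord_map, pbwCoord_pointsHom, pbwCoord_pointsHom]
  have := Scheme.ΓSpecIso_naturality (CommRingCat.ofHom φ.toRingHom)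
  exact congr($(this).hom (g.left.appTop.hom (AffineSpace.coord _ s)))

end Points

/-- Affine space is the spectrum of a polynomial ring, which is free over its coefficients. -/
theorem flat_pbwScheme (m : ℕ) : Flat (pbwScheme m).hom := by
  have h : (pbwScheme m).hom = (AffineSpace.SpecIso (Below m) (.of (SliceRing m))).hom ≫
      Spec.map (CommRingCat.ofHom MvPolynomial.C) := by
    rw [← AffineSpace.SpecIso_inv_over, Iso.hom_inv_id_assoc]
    rfl
  rw [h]
  have hi {X Y : Scheme.{0}} (e : X ≅ Y) : Flat e.hom := inferInstance
  refine @Flat.comp _ _ _ _ _ (hi _) (Flat.SpecMap_iff.mpr ?_)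
  exact RingHom.flat_algebraMap_iff.mpr (inferInstanceAs
    (Module.Flat (SliceRing m) (MvPolynomial (Below m) (SliceRing m))))

theorem locallyOfFiniteType_pbwScheme (m : ℕ) : LocallyOfFiniteType (pbwScheme m).hom :=
  inferInstanceAs (LocallyOfFiniteType
    (𝔸(Below m; Spec (.of (SliceRing m))) ↘ Spec (.of (SliceRing m))))

theorem isAffineHom_pbwScheme (m : ℕ) : IsAffineHom (pbwScheme m).hom :=
  inferInstanceAs (IsAffineHom
    (𝔸(Below m; Spec (.of (SliceRing m))) ↘ Spec (.of (SliceRing m))))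

end GroupScheme

/-! ### The contracting endomorphisms -/

section Scaling

variable {m : ℕ} {A B : Type} [CommRing A] [CommRing B]

/-- The endomorphism of `pbwGroup l` multiplying the entry at `(p, q)` by `c ^ (p - q)`. -/
def pbwGroup.scale {l : Fin m → A} (c : A) : pbwGroup l →* pbwGroup l :=
  MonoidHom.mk' (fun g => (⟨fun i => Matrix.GeneralLinearGroup.mk''
    (Matrix.of fun p q => (g.1 i).1 p q * c ^ ((p : ℕ) - q)) (by
      rw [Matrix.det_of_isLowerTriangular _ fun p q h => by
        rw [Matrix.of_apply, g.2.1 i h, zero_mul]]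
      simp [g.2.2.1 i]), by
    refine ⟨fun i p q h => ?_, fun i p => ?_, fun i => ?_⟩
    · exact (congrArg (· * _) (g.2.1 i h)).trans (zero_mul _)
    · refine (congrArg (· * _) (g.2.2.1 i p)).trans ?_
      simp
    · ext p q
      have := congrFun (congrFun (g.2.2.2 i) p) q
      rw [slice_mul_apply, mul_slice_apply] at this ⊢
      change _ * (_ * c ^ ((p : ℕ) - q)) = (_ * c ^ ((p : ℕ) - q)) * _
      rw [← mul_assoc, this]
      ring⟩ : pbwGroup l)) (by
    intro g h
    refine Subtype.ext (funext fun i => Units.ext ?_)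
    ext p q
    change ((g.1 i).1 * (h.1 i).1) p q * c ^ ((p : ℕ) - q) =
      (Matrix.of (fun p q => (g.1 i).1 p q * c ^ ((p : ℕ) - q)) *
        Matrix.of (fun p q => (h.1 i).1 p q * c ^ ((p : ℕ) - q))) p q
    rw [Matrix.mul_apply, Matrix.mul_apply, Finset.sum_mul]
    refine Finset.sum_congr rfl fun r _ => ?_
    rw [Matrix.of_apply, Matrix.of_apply]
    -- The truncated exponents add up only for `q ≤ r ≤ p`; for all other `r` one of the triangular
    -- factors vanishes.
    by_cases h1 : p < r
    · rw [g.2.1 i (show OrderDual.toDual r < OrderDual.toDual p from h1)]; ring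
    by_cases h2 : r < q
    · rw [h.2.1 i (show OrderDual.toDual q < OrderDual.toDual r from h2)]; ring
    rw [not_lt, Fin.le_def] at h1 h2
    rw [show (p : ℕ) - q = (p - r) + (r - q) by omega, pow_add]
    ring)

theorem pbwCoord_one {l : Fin m → A} (s : Below m) : pbwCoord l 1 s = 0 :=
  Matrix.one_apply_ne (ne_of_gt s.2)

end Scaling

/-! ### Unipotence via the grading by scaling -/

section Unipotent

open Polynomial

variable {m N : ℕ} {K : Type} [Field K] [Algebra (SliceRing m) K]

/-- Functoriality of the group of points in algebras over the slice. -/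
abbrev mapPoint {B B' : Type} [CommRing B] [Algebra (SliceRing m) B] [CommRing B']
    [Algebra (SliceRing m) B'] (φ : B →ₐ[SliceRing m] B') :
    pbwGroup (sliceParam m B) →* pbwGroup (sliceParam m B') :=
  pbwGroup.map φ.toRingHom fun _ => φ.commutes _

/-- The point of `pbwGroup` over `B[t]` obtained by scaling a point over `B` by `t`. -/
def scalePoint {B : Type} [CommRing B] [Algebra (SliceRing m) B] :
    pbwGroup (sliceParam m B) →* pbwGroup (sliceParam m B[X]) :=
  (pbwGroup.scale X).comp (mapPoint ((Algebra.ofId B B[X]).restrictScalars _))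

theorem pbwCoord_scalePoint {B : Type} [CommRing B] [Algebra (SliceRing m) B]
    (g : pbwGroup (sliceParam m B)) (s : Below m) :
    pbwCoord _ (scalePoint g) s = C (pbwCoord _ g s) * X ^ ((s.1.1 : ℕ) - s.1.2) := rfl

variable (r : ∀ (B : Type) [CommRing B] [Algebra (SliceRing m) B] [Algebra K B]
      [IsScalarTower (SliceRing m) K B], pbwGroup (sliceParam m B) →* GL (Fin N) B)

variable (hr : ∀ (B B' : Type) [CommRing B] [Algebra (SliceRing m) B] [Algebra K B]
      [IsScalarTower (SliceRing m) K B] [CommRing B'] [Algebra (SliceRing m) B'] [Algebra K B']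
      [IsScalarTower (SliceRing m) K B'] (φ : B →ₐ[K] B') (g : pbwGroup (sliceParam m B)),
      r B' (mapPoint (φ.restrictScalars (SliceRing m)) g) =
        Matrix.GeneralLinearGroup.map φ.toRingHom (r B g))

variable {B B' : Type} [CommRing B] [Algebra (SliceRing m) B] [Algebra K B]
      [IsScalarTower (SliceRing m) K B] [CommRing B'] [Algebra (SliceRing m) B'] [Algebra K B']
      [IsScalarTower (SliceRing m) K B']

/-- The component of degree `d` of the matrix of a representation. -/
def gradedPiece (d : ℕ) (g : pbwGroup (sliceParam m B)) : Matrix (Fin N) (Fin N) B :=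
  (r B[X] (scalePoint g)).1.map (coeff · d)

include hr

theorem map_rep (φ : B →ₐ[K] B') (g : pbwGroup (sliceParam m B)) :
    (r B' (mapPoint (φ.restrictScalars (SliceRing m)) g)).1 = (r B g).1.map φ :=
  congrArg Units.val (hr B B' φ g)

theorem rep_scalePoint_map (φ : B →ₐ[K] B') (g : pbwGroup (sliceParam m B)) :
    (r B'[X] (scalePoint (mapPoint (φ.restrictScalars (SliceRing m)) g))).1 =
      (r B[X] (scalePoint g)).1.map (mapAlgHom φ) := by
  rw [← map_rep r hr]
  congr 2
  refine (pbwCoord _).injective (funext fun s => ?_)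
  rw [pbwCoord_scalePoint, pbwCoord_map, pbwCoord_map, pbwCoord_scalePoint]
  simp

theorem gradedPiece_map (d : ℕ) (φ : B →ₐ[K] B') (g : pbwGroup (sliceParam m B)) :
    gradedPiece r d (mapPoint (φ.restrictScalars (SliceRing m)) g) =
      (gradedPiece r d g).map φ := by
  rw [gradedPiece, rep_scalePoint_map r hr]
  ext i j
  simp [gradedPiece]

/-- Scaling by `t = 1` is the identity, so `r(g)` is the sum of its graded pieces. -/
theorem rep_eq_map_eval (g : pbwGroup (sliceParam m B)) :
    (r B g).1 = (r B[X] (scalePoint g)).1.map (eval 1) := by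
  have h := map_rep r hr ((aeval (1 : B)).restrictScalars K : B[X] →ₐ[K] B) (scalePoint g)
  have h2 : mapPoint (((aeval (1 : B)).restrictScalars K : B[X] →ₐ[K] B).restrictScalars
      (SliceRing m)) (scalePoint g) = g := by
    refine (pbwCoord _).injective (funext fun s => ?_)
    rw [pbwCoord_map, pbwCoord_scalePoint]
    simp
  rw [h2] at h
  rw [h]
  ext i j
  simp

/-- Scaling by `t = 0` sends every point to the identity, since all exponents `p - q` are positive
below the diagonal. -/
theorem gradedPiece_zero (g : pbwGroup (sliceParam m B)) : gradedPiece r 0 g = 1 := by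
  have h := map_rep r hr ((aeval (0 : B)).restrictScalars K : B[X] →ₐ[K] B) (scalePoint g)
  have h2 : mapPoint (((aeval (0 : B)).restrictScalars K : B[X] →ₐ[K] B).restrictScalars
      (SliceRing m)) (scalePoint g) = 1 := by
    refine (pbwCoord _).injective (funext fun s => ?_)
    rw [pbwCoord_map, pbwCoord_scalePoint, pbwCoord_one]
    have : (s.1.2 : ℕ) < s.1.1 := s.2
    have h0 : (s.1.1 : ℕ) - s.1.2 ≠ 0 := by omega
    simp [h0]
  rw [h2, map_one] at h
  rw [show (1 : Matrix (Fin N) (Fin N) B) = (1 : GL (Fin N) B).1 from rfl, h]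
  ext i j
  simp [gradedPiece, coeff_zero_eq_eval_zero]

/-- Scaling twice is scaling by the product of the two variables, that is, base change along `X ↦ C
X * X` into `B[X][X]`. Thus the piece of degree `d` is homogeneous of degree `d`. -/
theorem gradedPiece_scalePoint (d : ℕ) (g : pbwGroup (sliceParam m B)) :
    gradedPiece r d (scalePoint g) = (gradedPiece r d g).map fun a => C a * X ^ d := by
  have h := map_rep r hr ((aeval (C X * X : B[X][X])).restrictScalars K : B[X] →ₐ[K] B[X][X])
    (scalePoint g)
  have h2 : mapPoint (((aeval (C X * X : B[X][X])).restrictScalars K :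
      B[X] →ₐ[K] B[X][X]).restrictScalars (SliceRing m)) (scalePoint g) =
        scalePoint (scalePoint g) := by
    refine (pbwCoord _).injective (funext fun s => ?_)
    rw [pbwCoord_map, pbwCoord_scalePoint, pbwCoord_scalePoint, pbwCoord_scalePoint]
    simp [mul_pow, mul_assoc]
  rw [h2] at h
  rw [gradedPiece, h]
  ext i j : 2
  simp only [gradedPiece, Matrix.map_apply, AlgHom.coe_restrictScalars']
  generalize (r B[X] (scalePoint g)).1 i j = p
  induction p using Polynomial.induction_on' with
  | add p q hp hq => simp only [map_add, coeff_add, hp, hq, add_mul]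
  | monomial n a =>
    rw [aeval_monomial, mul_pow, ← C_pow, Polynomial.algebraMap_apply, Polynomial.algebraMap_apply,
      Algebra.algebraMap_self, RingHom.id_apply, ← mul_assoc, ← C_mul, coeff_C_mul, coeff_X_pow,
      coeff_monomial]
    by_cases hd : d = n
    · simp [hd]
    · simp [hd, Ne.symm hd]

omit hr in
theorem gradedPiece_mul (d : ℕ) (g h : pbwGroup (sliceParam m B)) :
    gradedPiece r d (g * h) =
      ∑ a ∈ Finset.HasAntidiagonal.antidiagonal d, gradedPiece r a.1 g * gradedPiece r a.2 h := by
  rw [gradedPiece, map_mul, map_mul]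
  ext i j
  rw [Matrix.map_apply, Units.val_mul, Matrix.mul_apply, finsetSum_coeff, Matrix.sum_apply]
  simp only [coeff_mul, Matrix.mul_apply]
  rw [Finset.sum_comm]
  rfl

omit hr [Algebra (SliceRing m) B] [Algebra K B] [IsScalarTower (SliceRing m) K B] in
theorem map_C_mul_map_monomial (P Q : Matrix (Fin N) (Fin N) B) (e : ℕ) (i j : Fin N) :
    (P.map (algebraMap B B[X]) * Q.map (fun a => C a * X ^ e) : Matrix _ _ B[X]) i j =
      C ((P * Q) i j) * X ^ e := by
  simp [Matrix.mul_apply, map_sum, Finset.sum_mul, mul_assoc]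

/-- Over `B[s]`, the piece of degree `a + b` at `g (s·h)` vanishes. By homogeneity its coefficient
of `s^b` is the single product with degrees `a` and `b`. -/
theorem gradedPiece_mul_eq_zero {d : ℕ}
    (hd : ∀ g : pbwGroup (sliceParam m B[X]), ∀ e, d < e → gradedPiece r e g = 0)
    (g h : pbwGroup (sliceParam m B)) {a b : ℕ} (hab : d < a + b) :
    gradedPiece r a g * gradedPiece r b h = 0 := by
  have hs := hd (mapPoint (((Algebra.ofId B B[X]).restrictScalars K).restrictScalars _) g *
    scalePoint h) (a + b) hab
  rw [gradedPiece_mul] at hs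
  ext i j
  have := congrArg (coeff · b) (congrFun (congrFun hs i) j)
  simp only [Matrix.sum_apply, finsetSum_coeff] at this
  have key : ∀ x : ℕ × ℕ, coeff ((gradedPiece r x.1
      (mapPoint (((Algebra.ofId B B[X]).restrictScalars K).restrictScalars _) g) *
        gradedPiece r x.2 (scalePoint h)) i j) b =
      if b = x.2 then (gradedPiece r x.1 g * gradedPiece r x.2 h) i j else 0 := fun x => by
    rw [gradedPiece_map r hr, gradedPiece_scalePoint r hr]
    refine (congrArg (fun p : B[X] => coeff p b) (map_C_mul_map_monomial _ _ _ i j)).trans ?_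
    rw [coeff_C_mul_X_pow]
  rw [Finset.sum_congr rfl fun x _ => key x, Finset.sum_eq_single (a, b)] at this
  · simpa using this
  · rintro ⟨a', b'⟩ hx hne
    rw [Finset.HasAntidiagonal.mem_antidiagonal] at hx
    refine if_neg fun hb => hne ?_
    dsimp only at hb hx
    subst hb
    rw [Nat.add_right_cancel hx]
  · simp

/-- In the expansion of `r(g)` into graded pieces, all terms of positive degree kill the piece of
top degree `d`, and the term of degree `0` is `1`. -/
theorem rep_mul_gradedPiece {d : ℕ}
    (hd : ∀ g : pbwGroup (sliceParam m B[X]), ∀ e, d < e → gradedPiece r e g = 0)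
    (g h : pbwGroup (sliceParam m B)) :
    (r B g).1 * gradedPiece r d h = gradedPiece r d h := by
  have key : (r B[X] (scalePoint g)).1 * (gradedPiece r d h).map C =
      (gradedPiece r d h).map C := by
    refine Matrix.ext fun i j => Polynomial.ext fun a => ?_
    have h1 : coeff (((r B[X] (scalePoint g)).1 * (gradedPiece r d h).map C) i j) a =
        (gradedPiece r a g * gradedPiece r d h) i j := by
      rw [Matrix.mul_apply, finsetSum_coeff]
      simp only [Matrix.map_apply, coeff_mul_C, Matrix.mul_apply]
      rfl
    rw [h1, Matrix.map_apply, coeff_C]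
    split_ifs with ha
    · rw [ha, gradedPiece_zero r hr, one_mul]
    · rw [gradedPiece_mul_eq_zero r hr hd g h (by omega), Matrix.zero_apply]
  have := congrArg (fun M => M.map (evalRingHom 1)) key
  simp only [Matrix.map_mul, Matrix.map_map] at this
  rw [rep_eq_map_eval r hr]
  simpa [Function.comp_def] using this

theorem exists_fixed_vector (hN : 0 < N) : ∃ v : Fin N → K, v ≠ 0 ∧
    ∀ (B : Type) [CommRing B] [Algebra (SliceRing m) B] [Algebra K B]
      [IsScalarTower (SliceRing m) K B] (g : pbwGroup (sliceParam m B)),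
      (r B g).1.mulVec (fun j => algebraMap K B (v j)) = fun j => algebraMap K B (v j) := by
  -- The generic point: every point over a `K`-algebra is a specialization of it, so a bound on its
  -- degrees holds for all points.
  let g₀ : pbwGroup (sliceParam m (MvPolynomial (Below m) K)) :=
    (pbwCoord _).symm MvPolynomial.X
  have hgen : ∀ (B : Type) [CommRing B] [Algebra (SliceRing m) B] [Algebra K B]
      [IsScalarTower (SliceRing m) K B] (g : pbwGroup (sliceParam m B)),
      ∃ φ : MvPolynomial (Below m) K →ₐ[K] B,
        mapPoint (φ.restrictScalars (SliceRing m)) g₀ = g := by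
    intro B _ _ _ _ g
    refine ⟨MvPolynomial.aeval (pbwCoord _ g), (pbwCoord _).injective (funext fun s => ?_)⟩
    rw [pbwCoord_map, Equiv.apply_symm_apply]
    simp
  obtain ⟨d, hd0, hd⟩ : ∃ d, gradedPiece r d g₀ ≠ 0 ∧
      ∀ e, d < e → gradedPiece r e g₀ = 0 := by
    let T : Matrix (Fin N) (Fin N) (MvPolynomial (Below m) K)[X] :=
      (r (MvPolynomial (Below m) K)[X] (scalePoint g₀)).1
    let D : ℕ := Finset.univ.sup fun ij : Fin N × Fin N => (T ij.1 ij.2).natDegree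
    have hD : ∀ e, D < e → gradedPiece r e g₀ = 0 := fun e he => by
      refine Matrix.ext fun i j => coeff_eq_zero_of_natDegree_lt (lt_of_le_of_lt ?_ he)
      exact Finset.le_sup (f := fun ij : Fin N × Fin N => (T ij.1 ij.2).natDegree)
        (Finset.mem_univ (i, j))
    have h0 : gradedPiece r 0 g₀ ≠ 0 := fun h => by
      rw [gradedPiece_zero r hr] at h
      have := congrFun (congrFun h ⟨0, hN⟩) ⟨0, hN⟩
      simp at this
    classical
    refine ⟨Nat.findGreatest (fun d => gradedPiece r d g₀ ≠ 0) D,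
      Nat.findGreatest_spec (P := fun d => gradedPiece r d g₀ ≠ 0) (Nat.zero_le D) h0,
      fun e he => ?_⟩
    by_cases heD : e ≤ D
    · exact not_not.mp (Nat.findGreatest_is_greatest he heD)
    · exact hD e (not_le.mp heD)
  have hd' : ∀ (B : Type) [CommRing B] [Algebra (SliceRing m) B] [Algebra K B]
      [IsScalarTower (SliceRing m) K B] (g : pbwGroup (sliceParam m B)),
      ∀ e, d < e → gradedPiece r e g = 0 := by
    intro B _ _ _ _ g e he
    obtain ⟨φ, rfl⟩ := hgen B g
    rw [gradedPiece_map r hr, hd e he]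
    ext; simp
  obtain ⟨i₀, j₀, hij⟩ : ∃ i j, gradedPiece r d g₀ i j ≠ 0 := by
    by_contra! h
    exact hd0 (Matrix.ext h)
  obtain ⟨α, hα⟩ := MvPolynomial.exists_coeff_ne_zero hij
  refine ⟨fun i => MvPolynomial.coeff α (gradedPiece r d g₀ i j₀), fun h => hα (congrFun h i₀), ?_⟩
  intro B _ _ _ _ g
  -- Over the polynomial ring on `B`, the image of `g` has constant entries while `g₀` stays
  -- generic. The coefficient at `α` of the identity `r(g) r_d(g₀) = r_d(g₀)` is therefore the
  -- fixed-vector equation over `B`.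
  let c : B →ₐ[K] MvPolynomial (Below m) B :=
    (Algebra.ofId B (MvPolynomial (Below m) B)).restrictScalars K
  let ψ : MvPolynomial (Below m) K →ₐ[K] MvPolynomial (Below m) B :=
    MvPolynomial.mapAlgHom (Algebra.ofId K B)
  have key := rep_mul_gradedPiece r hr (hd' _) (mapPoint (c.restrictScalars (SliceRing m)) g)
    (mapPoint (ψ.restrictScalars (SliceRing m)) g₀)
  rw [map_rep r hr, gradedPiece_map r hr] at key
  funext i
  have := congrArg (MvPolynomial.coeff α) (congrFun (congrFun key i) j₀)
  rw [Matrix.mul_apply, MvPolynomial.coeff_sum] at this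
  rw [Matrix.mulVec, dotProduct]
  refine Eq.trans (Finset.sum_congr rfl fun k _ => ?_) (this.trans ?_)
  · simp [c, ψ, MvPolynomial.algebraMap_eq, MvPolynomial.coeff_C_mul, MvPolynomial.coeff_map]
  · simp [ψ, MvPolynomial.coeff_map]

end Unipotent

theorem isUnipotent_pbwScheme (m : ℕ) : IsUnipotent (pbwScheme m) where
  isAffineHom := isAffineHom_pbwScheme m
  exists_fixed K _ _ N r hr hN := by
    let e (B : Type) [CommRing B] [Algebra (SliceRing m) B] :
        Points (pbwScheme m) B ≃* pbwGroup (sliceParam m B) :=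
      MulEquiv.ofBijective (pointsHom m B) pointsHom_bijective
    obtain ⟨v, hv0, hv⟩ := exists_fixed_vector (K := K) (N := N)
      (fun B _ _ _ _ => (r B).comp (e B).symm.toMonoidHom) (by
        intro B B' _ _ _ _ _ _ _ _ φ g
        obtain ⟨g, rfl⟩ := (e B).surjective g
        have : mapPoint (φ.restrictScalars (SliceRing m)) (e B g) =
          e B' (Points.map _ (φ.restrictScalars (SliceRing m)) g) := (pointsHom_map _ g).symm
        rw [this]
        simpa using hr B B' φ g) hN
    refine ⟨v, hv0, fun B _ _ _ _ g => ?_⟩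
    have := hv B (e B g)
    simpa using this

/-! ### Open conditions along a line -/

section LinearAlgebra

open Module Filter

variable {K V X : Type} [Field K] [AddCommGroup V] [Module K V] [AddCommGroup X] [Module K X]

/-- The determinant is a polynomial in `s` with value `1` at `s = 0`, so it has finitely many roots.
-/
theorem eventually_det_one_add_smul_ne_zero {n : Type} [Fintype n] [DecidableEq n]
    (M : Matrix n n K) : ∀ᶠ s : K in cofinite, (1 + s • M).det ≠ 0 := by
  let P : Polynomial K := (1 + (Polynomial.X : Polynomial K) • M.map Polynomial.C).det
  have hP : ∀ s, P.eval s = (1 + s • M).det := fun s => by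
    rw [← Polynomial.coe_evalRingHom, RingHom.map_det]
    congr 1
    ext i j
    simp [Matrix.one_apply, apply_ite (Polynomial.eval s), mul_comm s]
  have h0 : P ≠ 0 := fun h => by
    have := hP 0
    simp [h] at this
  refine (P.rootSet_finite K).subset fun s hs => ?_
  rw [Set.mem_compl_iff, Set.mem_ofPred_eq, not_not] at hs
  rw [Polynomial.mem_rootSet]
  exact ⟨h0, by simpa [hP] using hs⟩

/-- A linear map sending `a` to the standard basis reduces independence to invertibility of `1 + s
M`. -/
theorem eventually_linearIndependent_add_smul {n : Type} [Finite n] {a : n → V}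
    (ha : LinearIndependent K a) (b : n → V) :
    ∀ᶠ s : K in cofinite, LinearIndependent K fun j => a j + s • b j := by
  classical
  have := Fintype.ofFinite n
  obtain ⟨φ, hφ⟩ : ∃ φ : V →ₗ[K] (n → K), ∀ j, φ (a j) = Pi.single j 1 := by
    obtain ⟨g, hg⟩ := LinearMap.exists_leftInverse_of_injective (Fintype.linearCombination K a)
      (LinearMap.ker_eq_bot.mpr ha.fintypeLinearCombination_injective)
    refine ⟨g, fun j => ?_⟩
    have := LinearMap.congr_fun hg (Pi.single j 1)
    simpa using this
  let M : Matrix n n K := Matrix.of fun j i => φ (b j) i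
  filter_upwards [eventually_det_one_add_smul_ne_zero M] with s hs
  refine LinearIndependent.of_comp φ ?_
  have := Matrix.linearIndependent_rows_of_det_ne_zero hs
  have h : (φ ∘ fun j => a j + s • b j) = fun j => (1 + s • M) j := by
    funext j i
    simp [hφ, M, Matrix.one_apply, Pi.single_apply, eq_comm]
  rw [h]
  exact this

/-- Lower semicontinuity of rank: lifts to `U` of a basis of the image under `A` keep independent
images for almost all `s`. -/
theorem eventually_finrank_map_le [FiniteDimensional K X] (U : Submodule K V)
    [FiniteDimensional K U] (A B : V →ₗ[K] X) :
    ∀ᶠ s : K in cofinite, finrank K (U.map A) ≤ finrank K (U.map (A + s • B)) := by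
  let c := Module.finBasis K (U.map A)
  choose x hxU hx using fun k => (Submodule.mem_map.mp (c k).2)
  have hc : LinearIndependent K fun k => (c k : X) :=
    c.linearIndependent.map' (U.map A).subtype (Submodule.ker_subtype _)
  filter_upwards [eventually_linearIndependent_add_smul hc fun k => B (x k)] with s hs
  have hle : Submodule.span K (Set.range fun k => (c k : X) + s • B (x k)) ≤
      U.map (A + s • B) := by
    rw [Submodule.span_le]
    rintro _ ⟨k, rfl⟩
    exact ⟨x k, hxU k, by simp [hx]⟩
  have := Submodule.finrank_mono hle
  rwa [finrank_span_eq_card hs, Fintype.card_fin] at this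

theorem finrank_map_eq_of_forall_eq_zero (U : Submodule K V) (A : V →ₗ[K] X)
    (h : ∀ v ∈ U, A v = 0 → v = 0) : finrank K (U.map A) = finrank K U := by
  rw [← LinearMap.range_domRestrict]
  refine LinearMap.finrank_range_of_inj (LinearMap.ker_eq_bot.mp ?_)
  rw [LinearMap.ker_eq_bot']
  exact fun v hv => Subtype.ext (h v v.2 hv)

end LinearAlgebra

/-! ### Degenerating flags in a chain of endomorphisms -/

section Chains

open Module Filter

variable {K V : Type} [Field K] [AddCommGroup V] [Module K V]

/-- The composite `f_{b-1} ∘ ⋯ ∘ f_a` of a chain of endomorphisms, for `a ≤ b`. -/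
def pathMap (f : ℕ → V →ₗ[K] V) (a : ℕ) : ℕ → V →ₗ[K] V
  | 0 => LinearMap.id
  -- For `a > b` the value is the identity, so such pairs contribute only `dim U_a` to the rank sum.
  | b + 1 => if a ≤ b then f b ∘ₗ pathMap f a b else LinearMap.id

variable {f : ℕ → V →ₗ[K] V}

theorem pathMap_self (a : ℕ) : pathMap f a a = LinearMap.id := by
  cases a with
  | zero => rfl
  | succ a => rw [pathMap, if_neg (by omega)]

theorem pathMap_succ {a b : ℕ} (h : a ≤ b) : pathMap f a (b + 1) = f b ∘ₗ pathMap f a b := by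
  rw [pathMap, if_pos h]

theorem pathMap_pathMap {a b c : ℕ} (hab : a ≤ b) (hbc : b ≤ c) (x : V) :
    pathMap f b c (pathMap f a b x) = pathMap f a c x := by
  induction c, hbc using Nat.le_induction with
  | base => rw [pathMap_self, LinearMap.id_apply]
  | succ c hbc ih =>
    rw [pathMap_succ hbc, pathMap_succ (hab.trans hbc), LinearMap.comp_apply, ih,
      LinearMap.comp_apply]

theorem pathMap_succ_self (a : ℕ) : pathMap f a (a + 1) = f a := by
  rw [pathMap_succ le_rfl, pathMap_self, LinearMap.comp_id]

theorem pathMap_apply_map {a b : ℕ} (hab : a + 1 ≤ b) (x : V) :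
    pathMap f (a + 1) b (f a x) = pathMap f a b x := by
  rw [← pathMap_succ_self (f := f) a, pathMap_pathMap (by omega) hab]

theorem map_pathMap_apply {a b : ℕ} (hab : a ≤ b) (x : V) :
    f b (pathMap f a b x) = pathMap f a (b + 1) x := by
  rw [pathMap_succ hab, LinearMap.comp_apply]

/-- Each map of the chain lowers the dimension of the image by at most one. -/
theorem le_finrank_range_pathMap [FiniteDimensional K V] {a b : ℕ} (hab : a ≤ b)
    (hf : ∀ i, a ≤ i → i < b → finrank K (LinearMap.ker (f i)) ≤ 1) :
    finrank K V ≤ finrank K (LinearMap.range (pathMap f a b)) + (b - a) := by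
  induction b, hab using Nat.le_induction with
  | base =>
    rw [pathMap_self, LinearMap.range_id]
    simp
  | succ b hab ih =>
    have h1 := ih fun i hi hib => hf i hi (by omega)
    have h2 := hf b hab (by omega)
    have h3 := LinearMap.finrank_range_add_finrank_ker
      ((f b).domRestrict (LinearMap.range (pathMap f a b)))
    have h4 : LinearMap.range ((f b).domRestrict (LinearMap.range (pathMap f a b))) =
        LinearMap.range (pathMap f a (b + 1)) := by
      rw [pathMap_succ hab, LinearMap.range_comp, LinearMap.range_domRestrict]
    have h5 : finrank K (LinearMap.ker
        ((f b).domRestrict (LinearMap.range (pathMap f a b)))) ≤ finrank K (LinearMap.ker (f b)) := by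
      rw [LinearMap.ker_domRestrict]
      exact LinearMap.finrank_le_finrank_of_injective
        (f := ((LinearMap.range (pathMap f a b)).subtype.restrict (p := (LinearMap.ker (f b)).comap _)
          (q := LinearMap.ker (f b)) fun x hx => hx)) fun x y hxy => by
            have := congrArg Subtype.val hxy
            exact Subtype.ext (Subtype.ext this)
    rw [h4] at h3
    omega

/-- A flag in a chain of endomorphisms: subspaces `U_0, …, U_m`, with `U_i` of dimension `i + 1`,
such that `f_i (U_i) ⊆ U_{i+1}`. -/
structure IsChainFlag (f : ℕ → V →ₗ[K] V) (m : ℕ) (U : ℕ → Submodule K V) : Prop where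
  finrank_eq : ∀ i ≤ m, finrank K (U i) = i + 1
  map_le : ∀ i < m, (U i).map (f i) ≤ U (i + 1)

/-- The sum of the ranks of the composites of the chain on a tuple of subspaces. -/
def rankSum (f : ℕ → V →ₗ[K] V) (m : ℕ) (U : ℕ → Submodule K V) : ℕ :=
  ∑ ab ∈ Finset.range (m + 1) ×ˢ Finset.range (m + 1),
    finrank K ((U ab.1).map (pathMap f ab.1 ab.2))

theorem rankSum_le [FiniteDimensional K V] (m : ℕ) (U : ℕ → Submodule K V) :
    rankSum f m U ≤ (m + 1) * (m + 1) * finrank K V := by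
  refine (Finset.sum_le_card_nsmul _ _ (finrank K V) fun ab _ => Submodule.finrank_le _).trans ?_
  simp

/-- A flag on which some map of the chain is not injective can be deformed along a line so that the
sum of the ranks increases. -/
theorem IsChainFlag.exists_deformation [FiniteDimensional K V] {m : ℕ} (hV : finrank K V = m + 2)
    (hf : ∀ i < m, finrank K (LinearMap.ker (f i)) ≤ 1) {U : ℕ → Submodule K V}
    (hU : IsChainFlag f m U) {i : ℕ} (hi : i < m) {v : V} (hvU : v ∈ U i) (hv : v ≠ 0)
    (hfv : f i v = 0) :
    ∃ T : ℕ → V →ₗ[K] V, ∀ᶠ s : K in cofinite,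
      IsChainFlag f m (fun l => (U l).map (LinearMap.id + s • T l)) ∧
      rankSum f m U < rankSum f m (fun l => (U l).map (LinearMap.id + s • T l)) := by
  classical
  have hex : ∃ j, j ≤ i ∧ v ∈ (U j).map (pathMap f j i) :=
    ⟨i, le_rfl, by rwa [pathMap_self, Submodule.map_id]⟩
  -- Trace the kernel vector `v` back along the flag as far as possible: `v` is the image of some
  -- `y` in `U_j`, with `j` minimal.
  obtain ⟨j, ⟨hji, y, hyU, hyv⟩, hmin⟩ : ∃ j, (j ≤ i ∧ v ∈ (U j).map (pathMap f j i)) ∧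
      ∀ k < j, ¬ (k ≤ i ∧ v ∈ (U k).map (pathMap f k i)) :=
    ⟨Nat.find hex, Nat.find_spec hex, fun k hk => Nat.find_min hex hk⟩
  -- By minimality `v` does not come from `U_{j-1}`, so a functional separates it from that image.
  -- For `j = 0` there is no such condition, and `v ≠ 0` suffices.
  obtain ⟨ξ, hξv, hξ⟩ : ∃ ξ : V →ₗ[K] K, ξ v = 1 ∧
      ∀ l, l + 1 = j → ∀ u ∈ U l, ξ (pathMap f l i u) = 0 := by
    let P : Submodule K V := ⨆ (l : ℕ) (_ : l + 1 = j), (U l).map (pathMap f l i)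
    have hvP : v ∉ P := by
      cases j with
      | zero => simpa [P] using hv
      | succ l =>
        have : P = (U l).map (pathMap f l i) := by simp [P]
        rw [this]
        exact fun h => hmin l (by omega) ⟨by omega, h⟩
    obtain ⟨ξ, hξ1, hξ2⟩ := Submodule.exists_le_ker_of_notMem hvP
    refine ⟨(ξ v)⁻¹ • ξ, by simp [hξ1], fun l hl u hu => ?_⟩
    have : pathMap f l i u ∈ P :=
      Submodule.mem_iSup_of_mem l (Submodule.mem_iSup_of_mem hl ⟨u, hu, rfl⟩)
    simp [LinearMap.mem_ker.mp (hξ2 this)]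
  -- Dimension count: the range of the composite from `j` to `i + 1` has dimension at least `(m + 2)
  -- - (i + 1 - j)`, so it meets `U_{i+1}`, of dimension `i + 2`, in dimension at least `j + 1`. The
  -- image of `U_j` has dimension at most `j`, since `y` is killed.
  obtain ⟨w, hwU, hw⟩ : ∃ w, pathMap f j (i + 1) w ∈ U (i + 1) ∧
      pathMap f j (i + 1) w ∉ (U j).map (pathMap f j (i + 1)) := by
    have h1 := le_finrank_range_pathMap (f := f) (show j ≤ i + 1 by omega)
      fun k _ hk => hf k (by omega)
    have h2 := hU.finrank_eq (i + 1) (by omega)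
    have h3 := Submodule.finrank_sup_add_finrank_inf_eq
      (LinearMap.range (pathMap f j (i + 1))) (U (i + 1))
    have h4 := Submodule.finrank_le (LinearMap.range (pathMap f j (i + 1)) ⊔ U (i + 1))
    have h5 : finrank K ((U j).map (pathMap f j (i + 1))) < j + 1 := by
      rw [← hU.finrank_eq j (by omega)]
      have h6 := LinearMap.finrank_range_add_finrank_ker ((pathMap f j (i + 1)).domRestrict (U j))
      rw [LinearMap.range_domRestrict] at h6
      have h7 : 0 < finrank K (LinearMap.ker ((pathMap f j (i + 1)).domRestrict (U j))) := by
        refine Module.finrank_pos_iff_exists_ne_zero.mpr ⟨⟨⟨y, hyU⟩, ?_⟩, fun h => hv ?_⟩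
        · rw [LinearMap.mem_ker, LinearMap.domRestrict_apply, pathMap_succ hji,
            LinearMap.comp_apply, hyv, hfv]
        · have : y = 0 := congrArg (fun z => (z.1 : V)) h
          rw [← hyv, this, map_zero]
      omega
    by_contra! hcon
    have h8 : LinearMap.range (pathMap f j (i + 1)) ⊓ U (i + 1) ≤
        (U j).map (pathMap f j (i + 1)) := by
      rintro _ ⟨⟨w, rfl⟩, hw⟩
      exact hcon w hw
    have := Submodule.finrank_mono h8
    omega
  -- The rank-one deformation pushes `y` in the direction `w` and transports this along the chain
  -- between `j` and `i`.
  let T : ℕ → V →ₗ[K] V := fun l =>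
    if j ≤ l ∧ l ≤ i then (ξ ∘ₗ pathMap f l i).smulRight (pathMap f j l w) else 0
  have hT1 : ∀ l, j ≤ l → l ≤ i → ∀ u, T l u = ξ (pathMap f l i u) • pathMap f j l w :=
    fun l h1 h2 u => by simp [T, h1, h2]
  have hT2 : ∀ l, ¬ (j ≤ l ∧ l ≤ i) → ∀ u, T l u = 0 := fun l h u => by simp [T, h]
  refine ⟨T, ?_⟩
  have e1 : ∀ᶠ s : K in cofinite, ∀ l ∈ Finset.range (m + 1),
      finrank K ((U l).map LinearMap.id) ≤ finrank K ((U l).map (LinearMap.id + s • T l)) :=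
    (Finset.eventually_all _).mpr fun l _ => eventually_finrank_map_le _ _ _
  have e2 : ∀ᶠ s : K in cofinite, ∀ ab ∈ Finset.range (m + 1) ×ˢ Finset.range (m + 1),
      finrank K ((U ab.1).map (pathMap f ab.1 ab.2)) ≤ finrank K ((U ab.1).map
        (pathMap f ab.1 ab.2 + s • (pathMap f ab.1 ab.2 ∘ₗ T ab.1))) :=
    (Finset.eventually_all _).mpr fun l _ => eventually_finrank_map_le _ _ _
  have e3 : ∀ᶠ s : K in cofinite, s ≠ 0 := eventually_cofinite_ne 0
  filter_upwards [e1, e2, e3] with s h1 h2 hs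
  have hcomp : ∀ a b, ((U a).map (LinearMap.id + s • T a)).map (pathMap f a b) =
      (U a).map (pathMap f a b + s • (pathMap f a b ∘ₗ T a)) := fun a b => by
    rw [← Submodule.map_comp]
    congr 1
    ext u
    simp
  refine ⟨⟨fun l hl => ?_, fun l hl => ?_⟩, ?_⟩
  · have := h1 l (by simpa using Nat.lt_succ_of_le hl)
    rw [Submodule.map_id, hU.finrank_eq l hl] at this
    exact le_antisymm ((Submodule.finrank_map_le _ _).trans (hU.finrank_eq l hl).le) this
  · rintro _ ⟨_, ⟨u, hu, rfl⟩, rfl⟩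
    have hfu : f l u ∈ U (l + 1) := hU.map_le l hl ⟨u, hu, rfl⟩
    simp only [LinearMap.add_apply, LinearMap.id_apply, LinearMap.smul_apply, map_add, map_smul]
    -- Strictly inside the interval `f` intertwines the deformations. At `l = i` the added vector
    -- already lies in `U_{i+1}`, and at `l = j - 1` the functional vanishes on what arrives from
    -- `U_l`.
    by_cases c1 : j ≤ l ∧ l < i
    · refine ⟨f l u, hfu, ?_⟩
      rw [hT1 l c1.1 c1.2.le, map_smul, map_pathMap_apply c1.1, LinearMap.add_apply,
        LinearMap.id_apply, LinearMap.smul_apply, hT1 (l + 1) (by omega) (by omega),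
        pathMap_apply_map (by omega)]
    by_cases c2 : l = i
    · subst c2
      refine ⟨f l u + s • f l (T l u), ?_, ?_⟩
      · rw [hT1 l hji le_rfl, map_smul, map_pathMap_apply hji]
        exact add_mem hfu (Submodule.smul_mem _ _ (Submodule.smul_mem _ _ hwU))
      · simp [hT2 (l + 1) (by omega)]
    refine ⟨f l u, hfu, ?_⟩
    rw [hT2 l (by omega)]
    by_cases c3 : l + 1 = j
    · rw [LinearMap.add_apply, LinearMap.smul_apply, hT1 (l + 1) (by omega) (by omega),
        pathMap_apply_map (by omega), hξ l c3 u hu]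
      simp
    · rw [LinearMap.add_apply, LinearMap.smul_apply, hT2 (l + 1) (by omega)]
      simp
  -- No rank drops for almost all `s`. The rank from `j` to `i + 1` grows: the deformed `y` now maps
  -- to a nonzero multiple of the image of `w`, and subtracting multiples of that image recovers the
  -- old image.
  · refine Finset.sum_lt_sum (fun ab hab => ?_) ⟨(j, i + 1), ?_, ?_⟩
    · rw [hcomp]
      exact h2 ab hab
    · simp only [Finset.mem_product, Finset.mem_range]
      omega
    · have him : ∀ u ∈ U j, pathMap f j (i + 1) u +
          (s * ξ (pathMap f j i u)) • pathMap f j (i + 1) w ∈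
            ((U j).map (LinearMap.id + s • T j)).map (pathMap f j (i + 1)) := fun u hu => by
        refine ⟨_, ⟨u, hu, rfl⟩, ?_⟩
        rw [LinearMap.add_apply, LinearMap.smul_apply, hT1 j le_rfl hji, pathMap_self,
          LinearMap.id_apply, LinearMap.id_apply, map_add, map_smul, map_smul, smul_smul]
      have hGw : pathMap f j (i + 1) w ∈
          ((U j).map (LinearMap.id + s • T j)).map (pathMap f j (i + 1)) := by
        have := him y hyU
        rw [hyv, hξv, mul_one, ← map_pathMap_apply hji, hyv, hfv, zero_add] at this
        simpa [smul_smul, hs] using Submodule.smul_mem _ s⁻¹ this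
      refine Submodule.finrank_lt_finrank_of_lt (lt_of_le_of_ne ?_ fun h => hw (h ▸ hGw))
      rintro _ ⟨u, hu, rfl⟩
      simpa using sub_mem (him u hu) (Submodule.smul_mem _ (s * ξ (pathMap f j i u)) hGw)

/-- A flag on which all maps of the chain are injective is generated by one vector in each step. -/
theorem IsChainFlag.exists_generators [FiniteDimensional K V] {m : ℕ} {U : ℕ → Submodule K V}
    (hU : IsChainFlag f m U) (hinj : ∀ i < m, ∀ v ∈ U i, f i v = 0 → v = 0) :
    ∃ u : ℕ → V, ∀ i ≤ m,
      U i = Submodule.span K (Set.range fun j : Fin (i + 1) => pathMap f j i (u j)) := by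
  -- `prev i` is the image of `U_{i-1}`, zero for `i = 0`. By injectivity it has dimension `i`, a
  -- hyperplane in `U_i`, so one further vector completes it.
  obtain ⟨prev, hp0, hps⟩ : ∃ prev : ℕ → Submodule K V,
      prev 0 = ⊥ ∧ ∀ k, prev (k + 1) = (U k).map (f k) :=
    ⟨fun i => Nat.rec ⊥ (fun k _ => (U k).map (f k)) i, rfl, fun _ => rfl⟩
  have hprev : ∀ i ≤ m, prev i ≤ U i ∧ finrank K ↥(prev i) = i := by
    intro i hi
    cases i with
    | zero => simp [hp0]
    | succ k =>
      have hk : k < m := hi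
      rw [hps]
      exact ⟨hU.map_le k hi, (finrank_map_eq_of_forall_eq_zero _ _ (hinj k hk)).trans
        (hU.finrank_eq k hk.le)⟩
  have hex : ∀ i, ∃ u, i ≤ m → U i = prev i ⊔ Submodule.span K {u} := by
    intro i
    by_cases hi : i ≤ m
    swap
    · exact ⟨0, fun h => absurd h hi⟩
    obtain ⟨h1, h2⟩ := hprev i hi
    have hlt : prev i < U i := lt_of_le_of_ne h1 fun h => by
      have := hU.finrank_eq i hi
      rw [← h, h2] at this
      omega
    obtain ⟨u, huU, hu⟩ := SetLike.exists_of_lt hlt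
    refine ⟨u, fun _ => (Submodule.eq_of_le_of_finrank_le ?_ ?_).symm⟩
    · exact sup_le h1 ((Submodule.span_singleton_le_iff_mem u _).mpr huU)
    · have hlt' : prev i < prev i ⊔ Submodule.span K {u} :=
        lt_of_le_of_ne le_sup_left fun h => hu <| by
          rw [h]
          exact Submodule.mem_sup_right (Submodule.mem_span_singleton_self u)
      have := Submodule.finrank_lt_finrank_of_lt hlt'
      rw [h2] at this
      rw [hU.finrank_eq i hi]
      exact this
  choose u hu using hex
  refine ⟨u, fun i => ?_⟩
  induction i with
  | zero =>
    intro _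
    rw [hu 0 (by omega)]
    simp [hp0, pathMap_self, Set.range_unique]
  | succ k ih =>
    intro hk
    rw [hu (k + 1) hk, hps, ih (by omega), Submodule.map_span, ← Submodule.span_union]
    congr 1
    ext x
    simp only [Set.mem_union, Set.mem_image, Set.mem_range, Set.mem_singleton_iff]
    constructor
    · rintro (⟨_, ⟨j, rfl⟩, rfl⟩ | rfl)
      · exact ⟨j.castSucc, (map_pathMap_apply j.is_le _).symm⟩
      · exact ⟨Fin.last _, by simp [pathMap_self]⟩
    · rintro ⟨j, rfl⟩
      induction j using Fin.lastCases with
      | last => exact Or.inr (by simp [pathMap_self])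
      | cast j => exact Or.inl ⟨_, ⟨j, rfl⟩, map_pathMap_apply j.is_le _⟩

/-- Every flag lies in the closure of the big cell of flags transversal to the kernels of `p_i`. -/
theorem IsChainFlag.mem_closure_bigCell [FiniteDimensional K V] {m : ℕ} (hV : finrank K V = m + 2)
    (hf : ∀ i < m, finrank K (LinearMap.ker (f i)) ≤ 1) {e : ℕ → V}
    (he : LinearIndependent K fun j : Fin (m + 2) => e j) (hfe : ∀ i < m, ∀ j ≤ i, f i (e j) = e j)
    {p : ℕ → V →ₗ[K] V} (hp : ∀ i ≤ m, ∀ j ≤ i, p i (e j) = e j)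
    {C : (ℕ → Submodule K V) → Prop}
    (hbig : ∀ U, IsChainFlag f m U → (∀ i ≤ m, Disjoint (U i) (LinearMap.ker (p i))) → C U)
    (hC : ∀ (U : ℕ → Submodule K V) (a b : ∀ i : ℕ, Fin (i + 1) → V), IsChainFlag f m U →
      (∀ i ≤ m, U i = Submodule.span K (Set.range (a i))) →
      (∀ᶠ s : K in cofinite, ∃ U', IsChainFlag f m U' ∧ C U' ∧
        ∀ i ≤ m, U' i = Submodule.span K (Set.range fun j => a i j + s • b i j)) → C U)
    {U : ℕ → Submodule K V} (hU : IsChainFlag f m U) : C U := by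
  -- Induction on the gap between the rank sum and its upper bound.
  induction hk : (m + 1) * (m + 1) * finrank K V - rankSum f m U using Nat.strong_induction_on
    generalizing U with
  | _ k ih =>
  by_cases hinj : ∀ i < m, ∀ v ∈ U i, f i v = 0 → v = 0
  · obtain ⟨u, hu⟩ := hU.exists_generators hinj
    -- Move the generators `u_j` along straight lines to `e_j`, reached at `s = 1`; as `e_j` is
    -- fixed by `f_i` for `i ≥ j`, the flag reached there is the coordinate flag.
    refine hC U (fun i j => pathMap f j i (u j)) (fun i j => pathMap f j i (e j - u j)) hU hu ?_
    have hpe : ∀ i j, j ≤ i → i ≤ m → pathMap f j i (e j) = e j := by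
      intro i j hji
      induction i, hji using Nat.le_induction with
      | base => exact fun _ => by rw [pathMap_self, LinearMap.id_apply]
      | succ i hji ih =>
        intro him
        rw [pathMap_succ hji, LinearMap.comp_apply, ih (by omega), hfe i (by omega) j hji]
    have key : ∀ᶠ t : K in cofinite, ∀ i ∈ Finset.range (m + 1),
        LinearIndependent K fun j : Fin (i + 1) =>
          p i (e j) + t • p i (pathMap f j i (e j - u j)) := by
      refine (Finset.eventually_all _).mpr fun i hi => ?_
      have him : i < m + 1 := Finset.mem_range.mp hi
      refine eventually_linearIndependent_add_smul ?_ _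
      have : (fun j : Fin (i + 1) => p i (e j)) =
          (fun j : Fin (m + 2) => e j) ∘ Fin.castLE (by omega) := by
        funext j
        exact hp i (by omega) j (by omega)
      rw [this]
      exact he.comp _ (Fin.castLE_injective _)
    -- With `t = s - 1` the frame is a perturbation of the `e_j`, where transversality holds; it
    -- therefore holds for almost all `s`.
    have key' := (sub_left_injective (b := (1 : K))).tendsto_cofinite.eventually key
    filter_upwards [key'] with s hs
    have hs' : ∀ i ≤ m, LinearIndependent K (p i ∘ fun j : Fin (i + 1) =>
        pathMap f j i (u j) + s • pathMap f j i (e j - u j)) := fun i hi => by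
      have := hs i (Finset.mem_range.mpr (by omega))
      convert this using 1
      funext j
      have h1 := hpe i j (by omega) hi
      rw [Function.comp_apply]
      simp only [map_add, map_smul, map_sub, h1]
      module
    have hflag : IsChainFlag f m fun i => Submodule.span K (Set.range fun j : Fin (i + 1) =>
        pathMap f j i (u j) + s • pathMap f j i (e j - u j)) := by
      refine ⟨fun i hi => ?_, fun i hi => ?_⟩
      · rw [finrank_span_eq_card (hs' i hi).of_comp, Fintype.card_fin]
      · rw [Submodule.map_span_le]
        rintro _ ⟨j, rfl⟩
        refine Submodule.subset_span ⟨j.castSucc, ?_⟩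
        simp only [Fin.val_castSucc, map_add, map_smul]
        rw [map_pathMap_apply (by omega), map_pathMap_apply (by omega)]
    exact ⟨_, hflag, hbig _ hflag fun i hi => Submodule.range_ker_disjoint (hs' i hi),
      fun i _ => rfl⟩
  · push Not at hinj
    obtain ⟨i, hi, v, hvU, hfv, hv⟩ := hinj
    obtain ⟨T, hT⟩ := hU.exists_deformation hV hf hi hvU hv hfv
    have hex : ∀ i, ∃ a : Fin (i + 1) → V, i ≤ m → U i = Submodule.span K (Set.range a) := by
      intro i
      by_cases hi : i ≤ m
      swap
      · exact ⟨0, fun h => absurd h hi⟩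
      let c := Module.finBasisOfFinrankEq K (U i) (hU.finrank_eq i hi)
      refine ⟨fun j => c j, fun _ => ?_⟩
      have := congrArg (Submodule.map (U i).subtype) c.span_eq
      rw [Submodule.map_span, Submodule.map_subtype_top, ← Set.range_comp] at this
      exact this.symm
    choose a ha using hex
    -- The deformed flags have larger rank sum, so the induction hypothesis covers almost all of the
    -- line through `U`.
    refine hC U a (fun i j => T i (a i j)) hU ha ?_
    filter_upwards [hT] with s hs
    refine ⟨_, hs.1, ih _ ?_ hs.1 rfl, fun i hi => ?_⟩
    · have := rankSum_le (f := f) m fun l => (U l).map (LinearMap.id + s • T l)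
      omega
    · rw [ha i hi, Submodule.map_span, ← Set.range_comp]
      rfl

end Chains

/-! ### Grassmannians and their base change -/

section Grassmannian

open Module

/-- The kernel of a surjection onto a free module of rank `k`, as a point of the Grassmannian. -/
def grassmannianOfSurjective {A M : Type} [CommRing A] [AddCommGroup M] [Module A M] {k : ℕ}
    (π : M →ₗ[A] Fin k → A) (hπ : Function.Surjective π) : Module.Grassmannian A M k where
  toSubmodule := LinearMap.ker π
  finite_quotient := Module.Finite.equiv (π.quotKerEquivOfSurjective hπ).symm
  projective_quotient := Module.Projective.of_equiv (π.quotKerEquivOfSurjective hπ).symm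
  rankAtStalk_eq p := by
    have := p.nontrivial
    rw [Module.rankAtStalk_eq_of_equiv (π.quotKerEquivOfSurjective hπ),
      Module.rankAtStalk_eq_finrank_of_free]
    simp

/-- The action of linear automorphisms on the Grassmannian. -/
def grassmannianMapEquiv {A M : Type} [CommRing A] [AddCommGroup M] [Module A M] {k : ℕ}
    (e : M ≃ₗ[A] M) (N : Module.Grassmannian A M k) : Module.Grassmannian A M k where
  toSubmodule := N.toSubmodule.map e.toLinearMap
  finite_quotient := Module.Finite.equiv (Submodule.Quotient.equiv N.toSubmodule _ e rfl)
  projective_quotient :=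
    Module.Projective.of_equiv (Submodule.Quotient.equiv N.toSubmodule _ e rfl)
  rankAtStalk_eq p := by
    rw [← Module.rankAtStalk_eq_of_equiv (Submodule.Quotient.equiv N.toSubmodule _ e rfl)]
    exact N.rankAtStalk_eq p

/-- A subspace of a vector space, as a point of the Grassmannian. -/
def grassmannianOfFinrank {K V : Type} [Field K] [AddCommGroup V] [Module K V]
    [FiniteDimensional K V] {k : ℕ} (U : Submodule K V) (hU : finrank K U + k = finrank K V) :
    Module.Grassmannian K V k where
  toSubmodule := U
  finite_quotient := inferInstance
  projective_quotient := inferInstance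
  rankAtStalk_eq p := by
    rw [Module.rankAtStalk_eq_finrank_of_free]
    have := U.finrank_quotient_add_finrank
    simp only [Pi.natCast_apply, Nat.cast_id]
    omega

theorem finrank_add_of_grassmannian {K V : Type} [Field K] [AddCommGroup V] [Module K V]
    [FiniteDimensional K V] {k : ℕ} (U : Module.Grassmannian K V k) :
    finrank K U.toSubmodule + k = finrank K V := by
  have h := U.rankAtStalk_eq ⟨⊥, Ideal.isPrime_bot⟩
  rw [Module.rankAtStalk_eq_finrank_of_free] at h
  have := U.toSubmodule.finrank_quotient_add_finrank
  simp only [Pi.natCast_apply, Nat.cast_id] at h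
  omega

/-- Right exactness of the tensor product. -/
theorem ker_baseChange_mkQ {A B W : Type} [CommRing A] [CommRing B] [Algebra A B]
    [AddCommGroup W] [Module A W] (N : Submodule A W) :
    LinearMap.ker (N.mkQ.baseChange B) = Submodule.span B ((fun w => (1 : B) ⊗ₜ[A] w) '' N) := by
  apply le_antisymm
  · intro z hz
    have hex := lTensor_exact B (LinearMap.exact_subtype_mkQ N) N.mkQ_surjective
    obtain ⟨y, rfl⟩ := (hex z).mp hz
    clear hz
    induction y using TensorProduct.induction_on with
    | zero => simp
    | tmul b n =>
      rw [LinearMap.lTensor_tmul, ← mul_one b, ← smul_eq_mul, ← smul_tmul']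
      exact Submodule.smul_mem _ _ (Submodule.subset_span ⟨n, n.2, rfl⟩)
    | add x y hx hy =>
      rw [map_add]
      exact add_mem hx hy
  · rw [Submodule.span_le]
    rintro _ ⟨n, hn, rfl⟩
    rw [SetLike.mem_coe, LinearMap.mem_ker, LinearMap.baseChange_tmul, Submodule.mkQ_apply,
      (Submodule.Quotient.mk_eq_zero _).mpr hn, tmul_zero]

variable {R M A B : Type} [CommRing R] [AddCommGroup M] [Module R M] [CommRing A] [Algebra R A]
  [CommRing B] [Algebra R B]

/-- The semilinear map `A ⊗ M → B ⊗ M` induced by an algebra homomorphism `A → B`. -/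
def scalarsMap (M : Type) [AddCommGroup M] [Module R M] (φ : A →ₐ[R] B) :
    A ⊗[R] M →ₛₗ[φ.toRingHom] B ⊗[R] M where
  toFun := TensorProduct.map φ.toLinearMap LinearMap.id
  map_add' := map_add _
  map_smul' a x := by
    induction x using TensorProduct.induction_on with
    | zero => simp
    | tmul c v => simp [smul_tmul']
    | add x y hx hy => simp only [smul_add, map_add, hx, hy]

theorem scalarsMap_tmul (φ : A →ₐ[R] B) (a : A) (x : M) :
    scalarsMap M φ (a ⊗ₜ x) = φ a ⊗ₜ x := rfl

/-- Replaces the description of base change as a kernel by generators, which turns equivariance and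
compatibility of the standard flag into computations with images. -/
theorem grassmannian_map_toSubmodule {k : ℕ} (φ : A →ₐ[R] B)
    (N : Module.Grassmannian A (A ⊗[R] M) k) :
    (Module.Grassmannian.map φ N).toSubmodule =
      Submodule.span B (scalarsMap M φ '' N.toSubmodule) := by
  algebraize [φ.toRingHom]
  have : IsScalarTower R A B := IsScalarTower.of_algebraMap_eq' φ.comp_algebraMap.symm
  have hc : ∀ (b : B) (x : A ⊗[R] M),
      AlgebraTensorModule.cancelBaseChange R A B B M (b ⊗ₜ x) = b • scalarsMap M φ x := by
    intro b x
    induction x using TensorProduct.induction_on with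
    | zero => rw [tmul_zero, map_zero, LinearMap.map_zero, smul_zero]
    | tmul a v =>
      rw [scalarsMap_tmul, AlgebraTensorModule.cancelBaseChange_tmul, smul_tmul', smul_eq_mul,
        Algebra.smul_def, mul_comm]
      rfl
    | add x y hx hy => simp only [tmul_add, map_add, hx, hy, smul_add]
  rw [Module.Grassmannian.map_toSubmodule]
  refine (LinearMap.ker_comp _ _).trans ?_
  rw [ker_baseChange_mkQ]
  refine (Submodule.map_equiv_eq_comap_symm
    (AlgebraTensorModule.cancelBaseChange R A B B M) _).symm.trans ?_
  rw [Submodule.map_span, Set.image_image]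
  congr 1
  refine Set.image_congr fun x _ => ?_
  exact (hc 1 x).trans (one_smul _ _)

end Grassmannian

/-! ### Matrices acting after base change -/

section Action

variable {R : Type} [CommRing R] {m : ℕ} {A B : Type} [CommRing A] [Algebra R A] [CommRing B]
  [Algebra R B]

theorem matAct_mul (M N : Matrix (Fin (m + 2)) (Fin (m + 2)) A) :
    matAct R (M * N) = matAct R M ∘ₗ matAct R N :=
  Matrix.toLin_mul _ _ _ _ _

theorem matAct_one : matAct R (1 : Matrix (Fin (m + 2)) (Fin (m + 2)) A) = LinearMap.id :=
  Matrix.toLin_one _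

/-- The automorphism of `A ⊗ R^{n+1}` with a given matrix in the standard basis. -/
def matActEquiv (R : Type) [CommRing R] {A : Type} [CommRing A] [Algebra R A]
    (g : GL (Fin (m + 2)) A) : A ⊗[R] (Fin (m + 2) → R) ≃ₗ[A] A ⊗[R] (Fin (m + 2) → R) :=
  LinearEquiv.ofLinearMap (matAct R g.1) (matAct R g⁻¹.1)
    (by rw [← matAct_mul, Units.mul_inv, matAct_one])
    (by rw [← matAct_mul, Units.inv_mul, matAct_one])

theorem matAct_stdBasis (M : Matrix (Fin (m + 2)) (Fin (m + 2)) A) (q : Fin (m + 2)) :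
    matAct R M (stdBasis R m A q) = ∑ p, M p q • stdBasis R m A p :=
  Matrix.toLin_self _ _ _ _

theorem scalarsMap_stdBasis (φ : A →ₐ[R] B) (q : Fin (m + 2)) :
    scalarsMap _ φ (stdBasis R m A q) = stdBasis R m B q := by
  rw [Module.Basis.baseChange_apply, scalarsMap_tmul, map_one, Module.Basis.baseChange_apply]

theorem scalarsMap_matAct (φ : A →ₐ[R] B) (M : Matrix (Fin (m + 2)) (Fin (m + 2)) A)
    (x : A ⊗[R] (Fin (m + 2) → R)) :
    scalarsMap _ φ (matAct R M x) = matAct R (M.map φ) (scalarsMap _ φ x) := by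
  have : (scalarsMap _ φ).comp (matAct R M) = (matAct R (M.map φ)).comp (scalarsMap _ φ) := by
    refine (stdBasis R m A).ext fun q => ?_
    rw [LinearMap.comp_apply, LinearMap.comp_apply, matAct_stdBasis, scalarsMap_stdBasis,
      matAct_stdBasis, map_sum]
    refine Finset.sum_congr rfl fun p _ => ?_
    rw [LinearMap.map_smulₛₗ, scalarsMap_stdBasis]
    rfl
  exact LinearMap.congr_fun this x

theorem baseChange_toLin' (M : Matrix (Fin (m + 2)) (Fin (m + 2)) R) :
    (Matrix.toLin' M).baseChange A = matAct R (M.map (algebraMap R A)) := by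
  refine (stdBasis R m A).ext fun q => ?_
  rw [matAct_stdBasis]
  simp only [Module.Basis.baseChange_apply, LinearMap.baseChange_tmul, Pi.basisFun_apply,
    Matrix.toLin'_apply, Matrix.mulVec_single_one, Matrix.map_apply]
  have : M.col q = ∑ p, M p q • (Pi.single p 1 : Fin (m + 2) → R) := by
    funext p
    simp [Finset.sum_apply, Pi.single_apply]
  rw [this, tmul_sum]
  refine Finset.sum_congr rfl fun p _ => ?_
  rw [tmul_smul, algebraMap_smul]

end Action

/-! ### The action on the family over the slice -/

section SliceAction

variable {m : ℕ} {A B : Type} [CommRing A] [Algebra (SliceRing m) A] [CommRing B]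
  [Algebra (SliceRing m) B]

theorem baseChange_univSlice (i : Fin m) :
    (Matrix.toLin' (univSlice m i)).baseChange A =
      matAct (SliceRing m) (slice (sliceParam m A) i) := by
  rw [baseChange_toLin', map_slice]

theorem baseChange_univSlice_stdBasis (i : Fin m) (q : Fin (m + 2)) :
    (Matrix.toLin' (univSlice m i)).baseChange A (stdBasis (SliceRing m) m A q) =
      (if q = i.succ.castSucc then sliceParam m A i else 1) • stdBasis (SliceRing m) m A q := by
  rw [baseChange_univSlice, matAct_stdBasis, Finset.sum_eq_single q]
  · rw [slice, Matrix.diagonal_apply_eq]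
  · intro p _ hp
    rw [slice, Matrix.diagonal_apply_ne _ hp, zero_smul]
  · simp

theorem repr_baseChange_univSlice (i : Fin m) (x : A ⊗[SliceRing m] (Fin (m + 2) → SliceRing m))
    (q : Fin (m + 2)) :
    (stdBasis (SliceRing m) m A).repr ((Matrix.toLin' (univSlice m i)).baseChange A x) q =
      (if q = i.succ.castSucc then sliceParam m A i else 1) *
        (stdBasis (SliceRing m) m A).repr x q := by
  have : ((stdBasis (SliceRing m) m A).coord q).comp
      ((Matrix.toLin' (univSlice m i)).baseChange A) =
      (if q = i.succ.castSucc then sliceParam m A i else 1) •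
        (stdBasis (SliceRing m) m A).coord q := by
    refine (stdBasis (SliceRing m) m A).ext fun p => ?_
    rw [LinearMap.comp_apply, baseChange_univSlice_stdBasis, map_smul, LinearMap.smul_apply,
      Module.Basis.coord_apply, Module.Basis.repr_self]
    by_cases hp : q = p
    · rw [hp]
    · rw [Finsupp.single_eq_of_ne hp, smul_zero, smul_zero]
  exact LinearMap.congr_fun this x

/-- The action `(g U)_i = g_i U_i` on the points of the family over the slice. -/
instance flagAction : MulAction (pbwGroup (sliceParam m A)) (DegFlag (univSlice m) A) where
  smul g U := ⟨fun i => grassmannianMapEquiv (matActEquiv _ (g.1 i)) (U.1 i), fun i => by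
    rintro _ ⟨u, hu, rfl⟩
    refine ⟨_, U.2 i hu, ?_⟩
    -- The relation `g_{i+1} f_i = f_i g_i` is what keeps the translated flag in the family.
    have h : matAct (SliceRing m) (g.1 i.succ).1 ∘ₗ matAct _ (slice (sliceParam m A) i) =
        matAct _ (slice (sliceParam m A) i) ∘ₗ matAct _ (g.1 i.castSucc).1 := by
      rw [← matAct_mul, ← matAct_mul, g.2.2.2 i]
    rw [baseChange_univSlice]
    exact LinearMap.congr_fun h u⟩
  one_smul U := Subtype.ext <| funext fun i => Module.Grassmannian.ext <| by
    change (U.1 i).toSubmodule.map (matAct (SliceRing m) 1) = _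
    rw [matAct_one, Submodule.map_id]
  mul_smul g h U := Subtype.ext <| funext fun i => Module.Grassmannian.ext <| by
    change (U.1 i).toSubmodule.map (matAct (SliceRing m) ((g.1 i).1 * (h.1 i).1)) =
      ((U.1 i).toSubmodule.map (matAct (SliceRing m) (h.1 i).1)).map
        (matAct (SliceRing m) (g.1 i).1)
    rw [matAct_mul, Submodule.map_comp]

theorem smul_toSubmodule (g : pbwGroup (sliceParam m A)) (U : DegFlag (univSlice m) A)
    (i : Fin (m + 1)) : ((g • U).1 i).toSubmodule =
      (U.1 i).toSubmodule.map (matAct (SliceRing m) (g.1 i).1) := rfl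

theorem map_smul_flag (φ : A →ₐ[SliceRing m] B) (g : pbwGroup (sliceParam m A))
    (U : DegFlag (univSlice m) A) :
    DegFlag.map (univSlice m) φ (g • U) = mapPoint φ g • DegFlag.map (univSlice m) φ U := by
  refine Subtype.ext (funext fun i => Module.Grassmannian.ext ?_)
  rw [smul_toSubmodule]
  change (Module.Grassmannian.map φ ((g • U).1 i)).toSubmodule =
    (Module.Grassmannian.map φ (U.1 i)).toSubmodule.map _
  rw [grassmannian_map_toSubmodule, grassmannian_map_toSubmodule, Submodule.map_span,
    smul_toSubmodule, Submodule.map_coe, Set.image_image, Set.image_image]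
  congr 1
  refine Set.image_congr fun x _ => ?_
  exact scalarsMap_matAct φ _ x

end SliceAction

/-! ### The section given by the standard flag -/

section StandardFlag

variable {m : ℕ}

/-- The coordinates with index larger than `i` of an element of `A ⊗ R^{n+1}`. -/
def lastCoords (R : Type) [CommRing R] (m : ℕ) (A : Type) [CommRing A] [Algebra R A]
    (i : Fin (m + 1)) : A ⊗[R] (Fin (m + 2) → R) →ₗ[A] Fin (m + 1 - (i : ℕ)) → A :=
  LinearMap.pi fun q => (stdBasis R m A).coord ⟨i + 1 + q, by omega⟩

theorem lastCoords_surjective (R : Type) [CommRing R] (m : ℕ) (A : Type) [CommRing A]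
    [Algebra R A] (i : Fin (m + 1)) : Function.Surjective (lastCoords R m A i) := by
  intro y
  refine ⟨∑ q, y q • stdBasis R m A ⟨i + 1 + q, by omega⟩, funext fun q => ?_⟩
  simp only [lastCoords, LinearMap.pi_apply, map_sum, map_smul, Module.Basis.coord_apply,
    Module.Basis.repr_self, smul_eq_mul]
  rw [Finset.sum_eq_single q]
  · simp
  · intro q' _ hq
    rw [Finsupp.single_eq_of_ne, mul_zero]
    intro h
    exact hq (Fin.ext (by have := congrArg Fin.val h; simp at this; omega))
  · simp

theorem mem_ker_lastCoords {R : Type} [CommRing R] {A : Type} [CommRing A]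
    [Algebra R A] {i : Fin (m + 1)} {x : A ⊗[R] (Fin (m + 2) → R)} :
    x ∈ LinearMap.ker (lastCoords R m A i) ↔
      ∀ p : Fin (m + 2), (i : ℕ) < p → (stdBasis R m A).repr x p = 0 := by
  rw [LinearMap.mem_ker]
  constructor
  · intro h p hp
    have := congrFun h ⟨p - (i + 1), by omega⟩
    simp only [lastCoords, LinearMap.pi_apply, Module.Basis.coord_apply, Pi.zero_apply] at this
    convert this using 2
    exact Fin.ext (by simp; omega)
  · intro h
    funext q
    exact h _ (by simp; omega)

theorem ker_lastCoords (R : Type) [CommRing R] (A : Type) [CommRing A]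
    [Algebra R A] (i : Fin (m + 1)) : LinearMap.ker (lastCoords R m A i) =
      Submodule.span A (stdBasis R m A '' {p | (p : ℕ) ≤ i}) := by
  ext x
  rw [mem_ker_lastCoords, Module.Basis.mem_span_image]
  constructor
  · intro h p hp
    by_contra hpi
    exact Finsupp.mem_support_iff.mp hp (h p (not_le.mp hpi))
  · intro h p hp
    by_contra hx
    exact absurd (h (Finsupp.mem_support_iff.mpr hx)) (not_le.mpr hp)

/-- The standard flag `⟨v_1, …, v_i⟩`, as a section of the family over the slice. -/
def stdFlag (m : ℕ) (A : Type) [CommRing A] [Algebra (SliceRing m) A] :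
    DegFlag (univSlice m) A :=
  ⟨fun i => grassmannianOfSurjective _ (lastCoords_surjective (SliceRing m) m A i), fun i => by
    change LinearMap.ker _ ≤ (LinearMap.ker _).comap _
    rw [ker_lastCoords, ker_lastCoords, Submodule.span_le]
    rintro _ ⟨p, hp, rfl⟩
    rw [SetLike.mem_coe, Submodule.mem_comap, baseChange_univSlice_stdBasis]
    refine Submodule.smul_mem _ _ (Submodule.subset_span ⟨p, ?_, rfl⟩)
    exact (show (p : ℕ) ≤ i from hp).trans (by simp)⟩

theorem stdFlag_toSubmodule {A : Type} [CommRing A] [Algebra (SliceRing m) A] (i : Fin (m + 1)) :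
    ((stdFlag m A).1 i).toSubmodule =
      Submodule.span A (stdBasis (SliceRing m) m A '' {p | (p : ℕ) ≤ i}) :=
  ker_lastCoords _ _ _

theorem map_stdFlag {A B : Type} [CommRing A] [Algebra (SliceRing m) A] [CommRing B]
    [Algebra (SliceRing m) B] (φ : A →ₐ[SliceRing m] B) :
    DegFlag.map (univSlice m) φ (stdFlag m A) = stdFlag m B := by
  refine Subtype.ext (funext fun i => Module.Grassmannian.ext ?_)
  change (Module.Grassmannian.map φ ((stdFlag m A).1 i)).toSubmodule = _
  rw [grassmannian_map_toSubmodule, stdFlag_toSubmodule, stdFlag_toSubmodule]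
  apply le_antisymm
  · rw [Submodule.span_le]
    rintro _ ⟨x, hx, rfl⟩
    induction hx using Submodule.span_induction with
    | mem x hx =>
      obtain ⟨p, hp, rfl⟩ := hx
      rw [scalarsMap_stdBasis]
      exact Submodule.subset_span ⟨p, hp, rfl⟩
    | zero => rw [LinearMap.map_zero]; exact zero_mem _
    | add x y _ _ hx hy => rw [LinearMap.map_add]; exact add_mem hx hy
    | smul a x _ hx => rw [LinearMap.map_smulₛₗ]; exact Submodule.smul_mem _ _ hx
  · rw [Submodule.span_le]
    rintro _ ⟨p, hp, rfl⟩
    refine Submodule.subset_span ⟨_, Submodule.subset_span ⟨p, hp, rfl⟩, ?_⟩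
    exact scalarsMap_stdBasis _ _

end StandardFlag

/-! ### Density of the orbit in a fibre -/

section Density

open Module

variable {m : ℕ} {K : Type} [Field K] [Algebra (SliceRing m) K]

/-- The chain of endomorphisms of the fibre, indexed by the natural numbers. -/
def fibreChain (m : ℕ) (K : Type) [Field K] [Algebra (SliceRing m) K] (i : ℕ) :
    K ⊗[SliceRing m] (Fin (m + 2) → SliceRing m) →ₗ[K]
      K ⊗[SliceRing m] (Fin (m + 2) → SliceRing m) :=
  -- The value for `i ≥ m` is arbitrary: only the maps with `i < m` enter the flag conditions and
  -- the composites up to vertex `m`.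
  if h : i < m then (Matrix.toLin' (univSlice m ⟨i, h⟩)).baseChange K else LinearMap.id

theorem fibreChain_of_lt {i : ℕ} (hi : i < m) :
    fibreChain m K i = (Matrix.toLin' (univSlice m ⟨i, hi⟩)).baseChange K :=
  dif_pos hi

theorem fibreChain_val (i : Fin m) :
    fibreChain m K i = (Matrix.toLin' (univSlice m i)).baseChange K :=
  dif_pos i.2

/-- The map is diagonal with at most one zero entry; this bound is what the slice contributes to the
dimension count in the deformation argument. -/
theorem finrank_ker_fibreChain_le (i : ℕ) (hi : i < m) :
    finrank K (LinearMap.ker (fibreChain m K i)) ≤ 1 := by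
  have h : LinearMap.ker (fibreChain m K i) ≤
      Submodule.span K {stdBasis (SliceRing m) m K (⟨i, hi⟩ : Fin m).succ.castSucc} := by
    intro x hx
    rw [LinearMap.mem_ker, fibreChain_of_lt hi] at hx
    have hx' : ∀ q, q ≠ (⟨i, hi⟩ : Fin m).succ.castSucc →
        (stdBasis (SliceRing m) m K).repr x q = 0 := fun q hq => by
      have h := repr_baseChange_univSlice (A := K) ⟨i, hi⟩ x q
      rw [hx, if_neg hq, one_mul, map_zero] at h
      exact h.symm
    rw [Submodule.mem_span_singleton]
    refine ⟨(stdBasis (SliceRing m) m K).repr x (⟨i, hi⟩ : Fin m).succ.castSucc,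
      Eq.trans ?_ ((stdBasis (SliceRing m) m K).sum_repr x)⟩
    refine (Fintype.sum_eq_single
      (f := fun q => (stdBasis (SliceRing m) m K).repr x q • stdBasis (SliceRing m) m K q)
      (⟨i, hi⟩ : Fin m).succ.castSucc fun q hq => ?_).symm
    rw [hx' q hq, zero_smul]
  exact (Submodule.finrank_mono h).trans ((finrank_span_le_card _).trans (by simp))

theorem finrank_fibre : finrank K (K ⊗[SliceRing m] (Fin (m + 2) → SliceRing m)) = m + 2 := by
  rw [Module.finrank_eq_card_basis (stdBasis (SliceRing m) m K), Fintype.card_fin]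

/-- The point of the linear degenerate flag variety given by a flag in the chain. -/
def flagOfChain {U : ℕ → Submodule K (K ⊗[SliceRing m] (Fin (m + 2) → SliceRing m))}
    (hU : IsChainFlag (fibreChain m K) m U) : DegFlag (univSlice m) K :=
  ⟨fun i => grassmannianOfFinrank (U i) (by
    rw [hU.finrank_eq i (by omega), finrank_fibre]; omega), fun i => by
    have := hU.map_le i i.2
    rw [fibreChain_val, Submodule.map_le_iff_le_comap] at this
    exact this⟩

/-- The subspaces of a point of the linear degenerate flag variety, indexed by the natural
numbers. -/
def chainOfFlag (D : DegFlag (univSlice m) K) (i : ℕ) :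
    Submodule K (K ⊗[SliceRing m] (Fin (m + 2) → SliceRing m)) :=
  if h : i < m + 1 then (D.1 ⟨i, h⟩).toSubmodule else ⊥

theorem chainOfFlag_val (D : DegFlag (univSlice m) K) (i : Fin (m + 1)) :
    chainOfFlag D i = (D.1 i).toSubmodule := dif_pos i.2

theorem isChainFlag_chainOfFlag (D : DegFlag (univSlice m) K) :
    IsChainFlag (fibreChain m K) m (chainOfFlag D) := by
  refine ⟨fun i hi => ?_, fun i hi => ?_⟩
  · have h := finrank_add_of_grassmannian (D.1 ⟨i, by omega⟩)
    rw [finrank_fibre] at h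
    rw [chainOfFlag, dif_pos (by omega)]
    dsimp only at h
    omega
  · have h := D.2 ⟨i, hi⟩
    rw [← fibreChain_val, ← Submodule.map_le_iff_le_comap] at h
    rw [chainOfFlag, chainOfFlag, dif_pos (by omega), dif_pos (by omega)]
    exact h

/-- The projection to the span of the basis vectors with index at most `i`. -/
def firstProj (m : ℕ) (K : Type) [Field K] [Algebra (SliceRing m) K] (i : ℕ) :
    K ⊗[SliceRing m] (Fin (m + 2) → SliceRing m) →ₗ[K]
      K ⊗[SliceRing m] (Fin (m + 2) → SliceRing m) :=
  (stdBasis (SliceRing m) m K).constr K fun q =>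
    if (q : ℕ) ≤ i then stdBasis (SliceRing m) m K q else 0

theorem repr_firstProj (i : ℕ) (x : K ⊗[SliceRing m] (Fin (m + 2) → SliceRing m))
    (p : Fin (m + 2)) : (stdBasis (SliceRing m) m K).repr (firstProj m K i x) p =
      if (p : ℕ) ≤ i then (stdBasis (SliceRing m) m K).repr x p else 0 := by
  rw [firstProj, Module.Basis.constr_apply_fintype, map_sum, Finsupp.coe_finsetSum,
    Finset.sum_apply, Finset.sum_eq_single p]
  · split_ifs <;> simp
  · intro q _ hq
    split_ifs <;> simp [hq.symm]
  · simp

/-- Transversality makes the projection of `U_q` onto the standard `q`-th subspace an isomorphism.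
The preimage `u_q` of the basis vector `v_q` then has the shape of column `q` of a lower
unitriangular matrix, and its coordinates are the parameters `x`. -/
theorem exists_smul_stdFlag_eq (D : DegFlag (univSlice m) K)
    (hD : ∀ i : Fin (m + 1), Disjoint (D.1 i).toSubmodule (LinearMap.ker (firstProj m K i))) :
    ∃ g : pbwGroup (sliceParam m K), g • stdFlag m K = D := by
  set b := stdBasis (SliceRing m) m K with hb
  have hfin : ∀ i : Fin (m + 1), finrank K (D.1 i).toSubmodule = i + 1 := fun i => by
    have := (isChainFlag_chainOfFlag D).finrank_eq i (by omega)
    rwa [chainOfFlag_val] at this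
  have hfinE : ∀ i : Fin (m + 1), finrank K ((stdFlag m K).1 i).toSubmodule = i + 1 := fun i => by
    have := (isChainFlag_chainOfFlag (stdFlag m K)).finrank_eq i (by omega)
    rwa [chainOfFlag_val] at this
  have hex : ∀ q : Fin (m + 1), ∃ u ∈ (D.1 q).toSubmodule,
      firstProj m K q u = b q.castSucc := by
    intro q
    have h1 : (D.1 q).toSubmodule.map (firstProj m K q) = ((stdFlag m K).1 q).toSubmodule := by
      refine Submodule.eq_of_le_of_finrank_eq ?_ ?_
      · rintro _ ⟨u, hu, rfl⟩
        refine mem_ker_lastCoords.mpr fun p hp => ?_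
        rw [repr_firstProj, if_neg (by omega)]
      · rw [hfinE, ← hfin q]
        exact finrank_map_eq_of_forall_eq_zero _ _ fun v hv hv' =>
          Submodule.disjoint_def.mp (hD q) v hv hv'
    have h2 : b q.castSucc ∈ ((stdFlag m K).1 q).toSubmodule := by
      rw [stdFlag_toSubmodule]
      exact Submodule.subset_span ⟨q.castSucc, show (q : ℕ) ≤ q from le_rfl, rfl⟩
    rw [← h1] at h2
    exact h2
  choose u huD hu using hex
  -- The last column has no entries below the diagonal, so its value is immaterial.
  let x : Fin (m + 2) → Fin (m + 2) → K := fun p q =>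
    if h : (q : ℕ) < m + 1 then b.repr (u ⟨q, h⟩) p else 0
  have hx : ∀ p (q : Fin (m + 1)), x p q.castSucc = b.repr (u q) p := fun p q => dif_pos q.2
  obtain ⟨g, hg⟩ := exists_pbwGroup_eq (sliceParam m K) x
  refine ⟨g, Subtype.ext (funext fun i => Module.Grassmannian.ext ?_)⟩
  have key : ∀ (q : Fin (m + 1)) (i : ℕ) (_ : (q : ℕ) ≤ i) (hi : i < m + 1),
      matAct (SliceRing m) (g.1 ⟨i, hi⟩).1 (b q.castSucc) ∈ (D.1 ⟨i, hi⟩).toSubmodule := by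
    intro q i hqi
    induction i, hqi using Nat.le_induction with
    | base =>
      intro _
      have : matAct (SliceRing m) (g.1 q).1 (b q.castSucc) = u q := by
        rw [matAct_stdBasis]
        refine Eq.trans (Finset.sum_congr rfl fun p _ => ?_) (b.sum_repr (u q))
        congr 1
        rw [hg q]
        by_cases hp : (q : ℕ) < p
        · rw [pbwMatrix_apply_of_lt _ _ _ (by simp) hp, hx]
        · have h1 := repr_firstProj q (u q) p
          rw [if_pos (by omega), hu, ← hb, Module.Basis.repr_self] at h1
          rw [← h1]
          by_cases hpq : p = q.castSucc
          · rw [hpq, pbwMatrix_apply_self, Finsupp.single_eq_same]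
          · rw [Finsupp.single_eq_of_ne hpq]
            refine pbwMatrix_lowerTriangular _ _ _ (show p < q.castSucc from ?_)
            exact lt_of_le_of_ne (by rw [Fin.le_def]; simpa using hp) hpq
      rw [show (⟨q, _⟩ : Fin (m + 1)) = q from rfl, this]
      exact huD q
    | succ i hqi ih =>
      intro hi
      -- Since `q ≤ i`, the map `f_i` fixes `v_q`, so `g_{i+1} v_q = g_{i+1} f_i v_q = f_i g_i v_q`
      -- lies in the next subspace.
      have h1 := D.2 ⟨i, by omega⟩ (ih (by omega))
      rw [Submodule.mem_comap, baseChange_univSlice, ← LinearMap.comp_apply, ← matAct_mul] at h1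
      have h2 := g.2.2.2 ⟨i, by omega⟩
      change slice _ _ * (g.1 ⟨i, by omega⟩).1 = (g.1 ⟨i + 1, hi⟩).1 * slice _ _ at h2
      rw [h2, matAct_mul, LinearMap.comp_apply, ← baseChange_univSlice,
        baseChange_univSlice_stdBasis, if_neg, one_smul] at h1
      · exact h1
      · intro h
        have := congrArg Fin.val h
        simp at this
        omega
  rw [smul_toSubmodule]
  refine Submodule.eq_of_le_of_finrank_eq ?_ ?_
  · rw [stdFlag_toSubmodule, Submodule.map_span_le]
    rintro _ ⟨p, hp, rfl⟩
    have hp' : (p : ℕ) ≤ i := hp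
    obtain ⟨q, rfl⟩ : ∃ q : Fin (m + 1), p = q.castSucc := ⟨⟨p, by omega⟩, Fin.ext rfl⟩
    exact key q i hp' i.2
  · exact (LinearEquiv.finrank_map_eq (matActEquiv (SliceRing m) (g.1 i)) _).trans
      ((hfinE i).trans (hfin i).symm)

/-- Along a line of frames each defining equation of a closed set becomes a polynomial in `s`, which
reduces density to `IsChainFlag.mem_closure_bigCell`. -/
theorem isZariskiDense_orbit [Infinite K] :
    IsZariskiDense (Set.range fun g : pbwGroup (sliceParam m K) => g • stdFlag m K) := by
  intro C hC hO D
  obtain ⟨S, hS⟩ := hC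
  set b := stdBasis (SliceRing m) m K with hb
  have hfr : ∀ (D : DegFlag (univSlice m) K)
      (c : ∀ i : ℕ, Fin (i + 1) → K ⊗[SliceRing m] (Fin (m + 2) → SliceRing m)),
      (∀ i ≤ m, chainOfFlag D i = Submodule.span K (Set.range (c i))) →
      IsFrame (fun (i : Fin (m + 1)) p j => b.repr (c i j) p) D.1 := by
    intro D c hc i
    rw [← chainOfFlag_val, hc i (by omega)]
    congr 2
    funext j
    exact (b.sum_repr _).symm
  have := IsChainFlag.mem_closure_bigCell (C := fun U => ∀ D : DegFlag (univSlice m) K,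
    (∀ i ≤ m, chainOfFlag D i = U i) → D.1 ∈ C) finrank_fibre
    (finrank_ker_fibreChain_le (m := m) (K := K))
    (e := fun j => if h : j < m + 2 then b ⟨j, h⟩ else 0) (p := firstProj m K)
    ?_ ?_ ?_ ?_ ?_ (isChainFlag_chainOfFlag D) D fun _ _ => rfl
  · exact this
  · have : (fun j : Fin (m + 2) => if h : (j : ℕ) < m + 2 then b ⟨j, h⟩ else 0) = b :=
      funext fun j => dif_pos j.2
    rw [this]
    exact b.linearIndependent
  · intro i hi j hj
    rw [dif_pos (by omega), fibreChain_of_lt hi,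
      baseChange_univSlice_stdBasis, if_neg, one_smul]
    intro h
    have := congrArg Fin.val h
    simp at this
    omega
  · intro i hi j hj
    rw [dif_pos (by omega), firstProj, Module.Basis.constr_basis, if_pos hj]
  · intro U _ hdisj D hDU
    obtain ⟨g, hg⟩ := exists_smul_stdFlag_eq D fun i => by
      rw [← chainOfFlag_val, hDU i (by omega)]
      exact hdisj i (by omega)
    exact hO D ⟨g, hg⟩
  · intro U c d hU hUc hev D hDU
    rw [hS D.1 _ (hfr D c fun i hi => (hDU i hi).trans (hUc i hi))]
    intro P hP
    let F : Polynomial K := MvPolynomial.aeval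
      (fun t : Σ i : Fin (m + 1), Fin (m + 2) × Fin ((i : ℕ) + 1) =>
        Polynomial.C (b.repr (c t.1 t.2.2) t.2.1) +
          Polynomial.X * Polynomial.C (b.repr (d t.1 t.2.2) t.2.1)) P
    have hF : ∀ s, F.eval s = MvPolynomial.eval
        (fun t : Σ i : Fin (m + 1), Fin (m + 2) × Fin ((i : ℕ) + 1) =>
          b.repr (c t.1 t.2.2 + s • d t.1 t.2.2) t.2.1) P := by
      intro s
      have : (Polynomial.evalRingHom s).comp (algebraMap K (Polynomial K)) = RingHom.id K := by
        ext; simp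
      change Polynomial.evalRingHom s (MvPolynomial.aeval _ P) = _
      rw [MvPolynomial.aeval_def, MvPolynomial.hom_eval₂, this]
      simp only [MvPolynomial.eval, MvPolynomial.coe_eval₂Hom]
      congr 1
      funext t
      simp [mul_comm s]
    -- `F` vanishes for all but finitely many `s`, hence identically as `K` is infinite; its value
    -- at `s = 0` is the equation for the given flag.
    have hF0 : F = 0 := by
      refine Polynomial.eq_zero_of_infinite_isRoot F (Set.Infinite.mono (fun s hs => ?_)
        (Set.Finite.infinite_compl (s := _) hev))
      rw [Set.mem_compl_iff, Set.mem_compl_iff, not_not] at hs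
      obtain ⟨U', hU', hC', hspan⟩ := hs
      have hch : ∀ i ≤ m, chainOfFlag (flagOfChain hU') i = U' i := fun i hi =>
        dif_pos (by omega)
      have hmem := hC' (flagOfChain hU') hch
      rw [hS _ _ (hfr (flagOfChain hU') (fun i j => c i j + s • d i j) fun i hi =>
        (hch i hi).trans (hspan i hi))] at hmem
      exact (hF s).trans (hmem P hP)
    have := hF 0
    rw [hF0, Polynomial.eval_zero] at this
    simpa using this.symm

end Density

end LinDeg

end

/-! ### The main theorem -/

theorem mainTheorem7 (m : ℕ) :
    ∃ (Γ : Over (Spec (.of (LinDeg.SliceRing m)))) (_ : GrpObj Γ)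
      (ρ : ∀ (A : Type) [CommRing A] [Algebra (LinDeg.SliceRing m) A],
        LinDeg.Points Γ A →* (Fin (m + 1) → GL (Fin (m + 2)) A))
      (act : ∀ (A : Type) [CommRing A] [Algebra (LinDeg.SliceRing m) A],
        MulAction (LinDeg.Points Γ A) (LinDeg.DegFlag (LinDeg.univSlice m) A)),
      -- `Γ` is a flat unipotent group scheme of finite type over the slice
      Flat Γ.hom ∧ LocallyOfFiniteType Γ.hom ∧ LinDeg.IsUnipotent Γ ∧
      -- `ρ` is a homomorphism from `Γ` to the `n`-fold product of `GL_{n+1}` over the slice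
      (∀ (A B : Type) [CommRing A] [Algebra (LinDeg.SliceRing m) A]
        [CommRing B] [Algebra (LinDeg.SliceRing m) B]
        (φ : A →ₐ[LinDeg.SliceRing m] B) (g : LinDeg.Points Γ A) (i : Fin (m + 1)),
        ρ B (LinDeg.Points.map Γ φ g) i =
          Matrix.GeneralLinearGroup.map φ.toRingHom (ρ A g i)) ∧
      -- it identifies `Γ` with the subfunctor of the tuples of explicit lower triangular matrices
      (∀ (A : Type) [CommRing A] [Algebra (LinDeg.SliceRing m) A],
        Function.Injective (ρ A) ∧
        ∀ g : Fin (m + 1) → GL (Fin (m + 2)) A, g ∈ Set.range (ρ A) ↔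
          ∃ x : Fin (m + 2) → Fin (m + 2) → A, ∀ i,
            (g i : Matrix (Fin (m + 2)) (Fin (m + 2)) A) =
              LinDeg.pbwMatrix
                (fun k => algebraMap (LinDeg.SliceRing m) A (MvPolynomial.X k)) x i) ∧
      -- the action of `Γ` on the family is `(g • U)_i = g_i U_i`
      (∀ (A : Type) [CommRing A] [Algebra (LinDeg.SliceRing m) A] (g : LinDeg.Points Γ A)
        (U : LinDeg.DegFlag (LinDeg.univSlice m) A) (i : Fin (m + 1)),
        (((act A).smul g U).1 i).toSubmodule =
          (U.1 i).toSubmodule.map (LinDeg.matAct (LinDeg.SliceRing m)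
            (ρ A g i : Matrix (Fin (m + 2)) (Fin (m + 2)) A))) ∧
      -- the action is a morphism over the slice
      (∀ (A B : Type) [CommRing A] [Algebra (LinDeg.SliceRing m) A]
        [CommRing B] [Algebra (LinDeg.SliceRing m) B]
        (φ : A →ₐ[LinDeg.SliceRing m] B) (g : LinDeg.Points Γ A)
        (U : LinDeg.DegFlag (LinDeg.univSlice m) A),
        LinDeg.DegFlag.map (LinDeg.univSlice m) φ ((act A).smul g U) =
          (act B).smul (LinDeg.Points.map Γ φ g)
            (LinDeg.DegFlag.map (LinDeg.univSlice m) φ U)) ∧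
      -- there is a section whose orbit is dense in every geometric fibre
      ∃ y : LinDeg.DegFlag (LinDeg.univSlice m) (LinDeg.SliceRing m),
        ∀ (K : Type) [Field K] [IsAlgClosed K] [Algebra (LinDeg.SliceRing m) K],
          LinDeg.IsZariskiDense (Set.range fun g : LinDeg.Points Γ K =>
            (act K).smul g (LinDeg.DegFlag.map (LinDeg.univSlice m)
              (Algebra.ofId (LinDeg.SliceRing m) K) y)) := by
  refine ⟨LinDeg.pbwScheme m, inferInstance,
    fun A _ _ => (LinDeg.pbwGroup _).subtype.comp (LinDeg.pointsHom m A),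
    fun A _ _ => MulAction.compHom _ (LinDeg.pointsHom m A),
    LinDeg.flat_pbwScheme m, LinDeg.locallyOfFiniteType_pbwScheme m,
    LinDeg.isUnipotent_pbwScheme m, fun A B _ _ _ _ φ g i => ?_, fun A _ _ => ⟨?_, fun g => ?_⟩,
    fun A _ _ g U i => rfl, fun A B _ _ _ _ φ g U => ?_, LinDeg.stdFlag m _, fun K _ _ _ => ?_⟩
  · exact congrArg (fun x => x.1 i) (LinDeg.pointsHom_map φ g)
  · exact Subtype.val_injective.comp LinDeg.pointsHom_bijective.1
  · refine Iff.trans ?_ LinDeg.mem_pbwGroup_iff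
    constructor
    · rintro ⟨p, rfl⟩
      exact (LinDeg.pointsHom m A p).2
    · intro hg
      obtain ⟨p, hp⟩ := LinDeg.pointsHom_bijective.2 ⟨g, hg⟩
      exact ⟨p, congrArg Subtype.val hp⟩
  · refine (LinDeg.map_smul_flag φ (LinDeg.pointsHom m A g) U).trans ?_
    exact congrArg (· • _) (LinDeg.pointsHom_map φ g).symm
  -- The section specializes to the standard flag of the fibre, and bijectivity on points identifies
  -- the two orbits.
  · have : Infinite K := IsAlgClosed.instInfinite
    rw [LinDeg.map_stdFlag]
    have h := LinDeg.isZariskiDense_orbit (m := m) (K := K)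
    rwa [← LinDeg.pointsHom_bijective.2.range_comp] at h
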